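/- Let $\Omega\subset\mathbb R^2$ be a bounded polygonal domain with Lipschitz boundary, let $n\ge 0$ and $q^1,\dots,q^n\in\mathbb R$, let $\epsilon:\bar\Omega\to\mathbb R$ be smooth with $\epsilon>0$ on $\bar\Omega$, and let $\sigma>0$. Write $(\cdot,\cdot)$ and $\|\cdot\|_{0}=\|\cdot\|_{0,\Omega}$ for the inner product and norm of $L^2(\Omega)$, and $\|\cdot\|_{0,\tau}$ for the norm of $L^2(\tau)$. Then there is a constant $C>0$, depending only on $\Omega$, $n$, $(q^i)$, $\epsilon$ and $\sigma$, such that the following holds. Let $\alpha,\gamma,g:\bar\Omega\times\mathbb R\to\mathbb R$ and $\beta:\bar\Omega\times\mathbb R\to\mathbb R^2$ be smooth and $f\in L^2(\Omega)$. Let $p^1,\dots,p^n,\phi\in H^1_0(\Omega)$ be a weak solution of the steady-state nonlinear Poisson--Nernst--Planck system, i.e. (with all integrals absolutely convergent) for all $v,w\in H_0^1(\Omega)$ and $1\le i\le n$, $$(\alpha(\cdot,p^i)\nabla p^i+\beta(\cdot,p^i),\nabla v)+(g(\cdot,p^i),v)+(\gamma(\cdot,p^i)\nabla\phi,\nabla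 v)=0,\qquad (\epsilon\nabla\phi,\nabla w)=\Big(\sum_{i=1}^n q^ip^i+f,\,w\Big).$$ Let $\mathcal T^h$ be a conforming triangulation of $\Omega$ that is shape regular with constant $\sigma$: each $\tau\in\mathcal T^h$, of diameter $h_\tau$, contains a disc of radius $r>0$ with $h_\tau\le\sigma r$. Let $S^h=\{v\in H^1(\Omega): v|_\tau \text{ is affine for all }\tau\in\mathcal T^h\}$, let $S^h_0=S^h\cap H^1_0(\Omega)$, and let $\varphi_z\in S^h$ be the nodal basis function of the vertex $z$. Let $p_h^1,\dots,p_h^n,\phi_h\in S_0^h$ satisfy the same two equations with $(p^i,\phi)$ replaced by $(p^i_h,\phi_h)$, for all $v,w\in S_0^h$. For each vertex $z$ let $\alpha_z^\tau\ge 0$ ($\tau\in\mathcal T^h$ having $z$ as a vertex) be weights with $\sum_{\tau}\alpha_z^\tau=1$, and let $$G_h\phi_h=\sum_{z}\Big(\sum_{\tau\ni z}\alpha_z^\tau\,\epsilon(z)\,(\nabla\phi_h)|_\tau\Big)\varphi_z$$ be the local-averaging flux recovery, the outer sum being over all vertices of $\mathcal T^h$. Then $$\|\nabla(\phi-\phi_h)\|_{0}\le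 C\Big(\eta_\phi+\sum_{i=1}^n\|p^i-p_h^i\|_{0}\Big),\qquad \eta_\phi=\sum_{\tau\in\mathcal T^h}\Big(h_\tau\|R_{1h}\|_{0,\tau}+\|D_h(\phi_h)\|_{0,\tau}\Big),$$ where $R_{1h}=\sum_{i=1}^n q^ip_h^i+\operatorname{div}(G_h\phi_h)+f$ and $D_h(\phi_h)=G_h\phi_h-\epsilon\nabla\phi_h$. -/

import Mathlib

open MeasureTheory
open scoped ContDiff

noncomputable section

namespace PNP

/-- The Euclidean plane. -/
abbrev Plane : Type := EuclideanSpace ℝ (Fin 2)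

/-! ### Domains -/

/-- Near each boundary point, in suitable orthonormal coordinates, `Ω` is the region strictly above
the graph of a Lipschitz function. -/
def HasLipschitzBoundary (Ω : Set Plane) : Prop :=
  ∀ x ∈ frontier Ω, ∃ r : ℝ, 0 < r ∧ ∃ (e : Plane ≃ᵃⁱ[ℝ] Plane) (K : NNReal) (ψ : ℝ → ℝ),
    LipschitzWith K ψ ∧ ∀ y ∈ Metric.ball x r, (y ∈ Ω ↔ ψ (e y 0) < e y 1)

/-- Bounded polygonal domains (nonempty, open and connected) with Lipschitz boundary. -/
structure IsPolygonalDomain (Ω : Set Plane) : Prop where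
  isOpen : IsOpen Ω
  isConnected : IsConnected Ω
  isBounded : Bornology.IsBounded Ω
  polygonal : ∃ S : Finset (Plane × Plane), frontier Ω = ⋃ s ∈ S, segment ℝ s.1 s.2
  lipschitz : HasLipschitzBoundary Ω

/-! ### Sobolev spaces -/

/-- `C_c^∞(Ω)`. -/
def IsTestFunction (Ω : Set Plane) (ψ : Plane → ℝ) : Prop :=
  ContDiff ℝ ∞ ψ ∧ HasCompactSupport ψ ∧ tsupport ψ ⊆ Ω

/-- `u ∈ L²(Ω)` has the weak gradient `G ∈ L²(Ω)²`. -/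
def HasWeakGrad (Ω : Set Plane) (u : Plane → ℝ) (G : Plane → Plane) : Prop :=
  MemLp u 2 (volume.restrict Ω) ∧ MemLp G 2 (volume.restrict Ω) ∧
    ∀ ψ : Plane → ℝ, IsTestFunction Ω ψ → ∀ y : Plane,
      ∫ x in Ω, u x * fderiv ℝ ψ x y = -∫ x in Ω, inner ℝ (G x) y * ψ x

/-- `H¹(Ω)`. -/
def MemH1 (Ω : Set Plane) (u : Plane → ℝ) : Prop := ∃ G, HasWeakGrad Ω u G

open Classical in
/-- The weak gradient of a function in `H¹(Ω)` (unique up to null sets in `Ω`). -/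
def weakGrad (Ω : Set Plane) (u : Plane → ℝ) : Plane → Plane :=
  if h : MemH1 Ω u then h.choose else 0

/-- `H¹₀(Ω)`, the closure of `C_c^∞(Ω)` in `H¹(Ω)`. -/
def MemH10 (Ω : Set Plane) (u : Plane → ℝ) : Prop :=
  MemH1 Ω u ∧ ∀ δ : ENNReal, 0 < δ → ∃ ψ : Plane → ℝ, IsTestFunction Ω ψ ∧
    eLpNorm (fun x => u x - ψ x) 2 (volume.restrict Ω) < δ ∧
    eLpNorm (fun x => weakGrad Ω u x - gradient ψ x) 2 (volume.restrict Ω) < δ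

/-- The norm `‖F‖_{0,S}` of `L²(S)`, for scalar or vector fields. -/
def l2norm {V : Type*} [NormedAddCommGroup V] (S : Set Plane) (F : Plane → V) : ℝ :=
  (eLpNorm F 2 (volume.restrict S)).toReal

/-! ### Triangulations and finite elements -/

/-- A conforming triangulation of `Ω`. A triangle is given by the set of its three vertices, and
two closed triangles meet exactly in the convex hull of their common vertices. -/
structure Triangulation (Ω : Set Plane) where
  cells : Finset (Finset Plane)
  card_eq : ∀ t ∈ cells, t.card = 3
  indep : ∀ t ∈ cells, AffineIndependent ℝ (fun z : t => (z : Plane))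
  inter : ∀ s ∈ cells, ∀ t ∈ cells,
    convexHull ℝ (s : Set Plane) ∩ convexHull ℝ (t : Set Plane)
      = convexHull ℝ ((s : Set Plane) ∩ (t : Set Plane))
  cover : ⋃ t ∈ cells, convexHull ℝ (t : Set Plane) = closure Ω

/-- The closed triangle with vertex set `t`. -/
def tri (t : Finset Plane) : Set Plane := convexHull ℝ (t : Set Plane)

/-- The diameter `h_τ`. -/
def cellDiam (t : Finset Plane) : ℝ := Metric.diam (tri t)

namespace Triangulation

variable {Ω : Set Plane}

/-- Shape regularity with constant `σ`: each triangle contains a disc of radius `r > 0` with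
`h_τ ≤ σ r`. -/
def ShapeRegular (T : Triangulation Ω) (σ : ℝ) : Prop :=
  ∀ t ∈ T.cells, ∃ (x : Plane) (r : ℝ), 0 < r ∧ Metric.closedBall x r ⊆ tri t ∧
    cellDiam t ≤ σ * r

open Classical in
/-- The set of all vertices. -/
def vertices (T : Triangulation Ω) : Finset Plane := T.cells.biUnion id

/-- The linear finite element space `S^h`: functions in `H¹(Ω)` that are affine on each (closed)
triangle. -/
def MemS (T : Triangulation Ω) (v : Plane → ℝ) : Prop :=
  MemH1 Ω v ∧ ∀ t ∈ T.cells, ∃ l : Plane →ᵃ[ℝ] ℝ, Set.EqOn v l (tri t)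

/-- `S^h_0 = S^h ∩ H¹₀(Ω)`. -/
def MemS0 (T : Triangulation Ω) (v : Plane → ℝ) : Prop := T.MemS v ∧ MemH10 Ω v

/-- The vertices of a triangle as an affine basis of the plane; its coordinates are the barycentric
coordinates of the triangle. -/
def affineBasis (T : Triangulation Ω) (t : Finset Plane) (ht : t ∈ T.cells) :
    AffineBasis t ℝ Plane where
  toFun := fun z => (z : Plane)
  ind' := T.indep t ht
  tot' := by
    rw [(T.indep t ht).affineSpan_eq_top_iff_card_eq_finrank_add_one]
    simp [T.card_eq t ht]

open Classical in
/-- The nodal basis function `φ_z`: on a triangle with vertex `z` it is the barycentric coordinate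
belonging to `z` (the same for all such triangles through the point), elsewhere it vanishes. -/
def nodalBasis (T : Triangulation Ω) (z x : Plane) : ℝ :=
  if h : ∃ t, ∃ _ : t ∈ T.cells, z ∈ t ∧ x ∈ tri t then
    (T.affineBasis h.choose h.choose_spec.1).coord ⟨z, h.choose_spec.2.1⟩ x
  else 0

open Classical in
/-- Admissible averaging weights `α_z^τ`, for `τ` in the patch of `z`: nonnegative with sum one. -/
def IsAveragingWeight (T : Triangulation Ω) (wt : Plane → Finset Plane → ℝ) : Prop :=
  ∀ z ∈ T.vertices, (∀ t ∈ T.cells, z ∈ t → 0 ≤ wt z t) ∧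
    ∑ t ∈ T.cells with z ∈ t, wt z t = 1

/-- The constant gradient on a triangle `t` of a function that is affine on `t`, evaluated at the
centroid, an interior point of `t`. -/
def cellGrad (v : Plane → ℝ) (t : Finset Plane) : Plane := gradient v (t.centroid ℝ id)

open Classical in
/-- The recovered flux `G_h v = ∑_z (∑_{τ ∋ z} α_z^τ ε(z) (∇v)|_τ) φ_z`. -/
def fluxRecovery (T : Triangulation Ω) (wt : Plane → Finset Plane → ℝ) (ε : Plane → ℝ)
    (v : Plane → ℝ) (x : Plane) : Plane :=
  ∑ z ∈ T.vertices, T.nodalBasis z x •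
    ∑ t ∈ T.cells with z ∈ t, wt z t • ε z • cellGrad v t

end Triangulation

/-- The divergence of a vector field; for a piecewise affine field it is defined off the edges. -/
def divergence (F : Plane → Plane) (x : Plane) : ℝ :=
  ∑ k : Fin 2, fderiv ℝ F x (EuclideanSpace.single k 1) k

/-! ### The Poisson–Nernst–Planck system -/

/-- `a(w,v) = (α(·,w)∇w + β(·,w), ∇v) + (g(·,w), v)`. -/
def formA (Ω : Set Plane) (α : Plane → ℝ → ℝ) (β : Plane → ℝ → Plane) (g : Plane → ℝ → ℝ)
    (w v : Plane → ℝ) : ℝ :=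
  (∫ x in Ω, inner ℝ (α x (w x) • weakGrad Ω w x + β x (w x)) (weakGrad Ω v x))
    + ∫ x in Ω, g x (w x) * v x

/-- `b(w,ψ,v) = (γ(·,w)∇ψ, ∇v)`. -/
def formB (Ω : Set Plane) (γ : Plane → ℝ → ℝ) (w ψ v : Plane → ℝ) : ℝ :=
  ∫ x in Ω, inner ℝ (γ x (w x) • weakGrad Ω ψ x) (weakGrad Ω v x)

/-- `ã(w,v) = (ε∇w, ∇v)`. -/
def formE (Ω : Set Plane) (ε : Plane → ℝ) (w v : Plane → ℝ) : ℝ :=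
  ∫ x in Ω, inner ℝ (ε x • weakGrad Ω w x) (weakGrad Ω v x)

/-- The charge `f̃(p) = ∑ qⁱ pⁱ + f`. -/
def charge {n : ℕ} (q : Fin n → ℝ) (f : Plane → ℝ) (p : Fin n → Plane → ℝ) (x : Plane) : ℝ :=
  ∑ i, q i * p i x + f x

/-- Weak solutions `(p¹, …, pⁿ, φ)` of the system with homogeneous Dirichlet conditions. The
integrals of the nonlinear forms are required to converge absolutely. -/
structure IsWeakSolution (Ω : Set Plane) {n : ℕ} (q : Fin n → ℝ)
    (α : Plane → ℝ → ℝ) (β : Plane → ℝ → Plane) (γ g : Plane → ℝ → ℝ) (ε f : Plane → ℝ)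
    (p : Fin n → Plane → ℝ) (φ : Plane → ℝ) : Prop where
  p_mem : ∀ i, MemH10 Ω (p i)
  phi_mem : MemH10 Ω φ
  integrable_flux : ∀ i, ∀ v, MemH10 Ω v → IntegrableOn
    (fun x => inner ℝ (α x (p i x) • weakGrad Ω (p i) x + β x (p i x)) (weakGrad Ω v x)) Ω
  integrable_reaction : ∀ i, ∀ v, MemH10 Ω v → IntegrableOn (fun x => g x (p i x) * v x) Ω
  integrable_drift : ∀ i, ∀ v, MemH10 Ω v → IntegrableOn
    (fun x => inner ℝ (γ x (p i x) • weakGrad Ω φ x) (weakGrad Ω v x)) Ω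
  concentration : ∀ i, ∀ v, MemH10 Ω v → formA Ω α β g (p i) v + formB Ω γ (p i) φ v = 0
  potential : ∀ w, MemH10 Ω w → formE Ω ε φ w = ∫ x in Ω, charge q f p x * w x

/-- Finite element solutions `(p¹_h, …, pⁿ_h, φ_h)` in `S^h_0`. -/
structure IsFESolution {Ω : Set Plane} (T : Triangulation Ω) {n : ℕ} (q : Fin n → ℝ)
    (α : Plane → ℝ → ℝ) (β : Plane → ℝ → Plane) (γ g : Plane → ℝ → ℝ) (ε f : Plane → ℝ)
    (ph : Fin n → Plane → ℝ) (φh : Plane → ℝ) : Prop where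
  p_mem : ∀ i, T.MemS0 (ph i)
  phi_mem : T.MemS0 φh
  concentration : ∀ i, ∀ v, T.MemS0 v → formA Ω α β g (ph i) v + formB Ω γ (ph i) φh v = 0
  potential : ∀ w, T.MemS0 w → formE Ω ε φh w = ∫ x in Ω, charge q f ph x * w x

/-! ### The error estimator -/

/-- `R_{1h} = ∑ qⁱ pⁱ_h + div(G_h φ_h) + f`. -/
def residual {Ω : Set Plane} (T : Triangulation Ω) (wt : Plane → Finset Plane → ℝ)
    {n : ℕ} (q : Fin n → ℝ) (ε f : Plane → ℝ) (ph : Fin n → Plane → ℝ) (φh : Plane → ℝ)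
    (x : Plane) : ℝ :=
  ∑ i, q i * ph i x + divergence (T.fluxRecovery wt ε φh) x + f x

/-- `D_h(φ_h) = G_h φ_h - ε∇φ_h`. -/
def fluxDefect {Ω : Set Plane} (T : Triangulation Ω) (wt : Plane → Finset Plane → ℝ)
    (ε : Plane → ℝ) (φh : Plane → ℝ) (x : Plane) : Plane :=
  T.fluxRecovery wt ε φh x - ε x • weakGrad Ω φh x

/-- `η_φ = ∑_τ (h_τ ‖R_{1h}‖_{0,τ} + ‖D_h(φ_h)‖_{0,τ})`. -/
def estimator {Ω : Set Plane} (T : Triangulation Ω) (wt : Plane → Finset Plane → ℝ)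
    {n : ℕ} (q : Fin n → ℝ) (ε f : Plane → ℝ) (ph : Fin n → Plane → ℝ) (φh : Plane → ℝ) : ℝ :=
  ∑ t ∈ T.cells, (cellDiam t * l2norm (tri t) (residual T wt q ε f ph φh)
    + l2norm (tri t) (fluxDefect T wt ε φh))

end PNP

end

/-! The potential solves a linear elliptic equation whose right-hand side contains the
concentrations, so the estimate is a residual bound in which `p - p_h` acts as a perturbation of the
data. Put `e = φ - φ_h`. For every `w ∈ S^h_0`, Galerkin orthogonality and integration by parts for
the recovered flux `G = G_h φ_h` give (`error_representation`) `(ε∇e, ∇e) = (∑ qⁱ(pⁱ - pⁱ_h), e) +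
(R_{1h}, e - w) + (D_h, ∇(e - w))`. There are no edge terms, because `G` is continuous across edges
and has a square-integrable divergence. The left side is at least `min ε * ‖∇e‖²`. The first term on
the right is bounded by the Poincaré inequality, the other two triangle by triangle, with `w` a
quasi-interpolant of `e` such that `‖e - w‖_τ ≤ M h_τ ‖∇e‖_Ω` and `‖∇w‖_τ ≤ M ‖∇e‖_Ω`. Dividing by
`‖∇e‖` finishes the proof. Since `η_φ` is a plain sum over the triangles and not a root of a sum of
squares, the norm of `∇e` over all of `Ω` is allowed on the right, and no overlap of patches has to
be counted.

The quasi-interpolant (`exists_quasi_interpolation`) rests on three facts. (1) The extension by zero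
`U` of a function in `H¹₀(Ω)` satisfies `‖U(· + h) - U‖ ≤ |h| ‖∇u‖`. Averaging over translations
yields a Poincaré inequality on balls with a point value `U y` in place of the mean
(`MemH10.exists_eLpNorm_sub_le`). If `y` ranges over a ball outside `Ω`, then `U y = 0`; the
Lipschitz boundary supplies such balls at every scale (`exists_exterior_ball`). (2) Shape regularity
makes the diameters of the triangles at an interior vertex comparable (`ShapeRegular.cellDiam_le`),
so that one ball serves all of them. (3) A piecewise affine function vanishing off `Ω` lies in
`H¹₀(Ω)` as the closure of test functions (`IsPiecewiseAffine.memH10`), by truncation and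
mollification. -/

noncomputable section

namespace PNP

variable {Ω : Set Plane}

/-! ### Square-integrable functions -/

section L2

variable {X V : Type*} [MeasurableSpace X] {μ : Measure X} [NormedAddCommGroup V]
  [InnerProductSpace ℝ V]

lemma integrable_inner_of_memLp {F G : X → V} (hF : MemLp F 2 μ) (hG : MemLp G 2 μ) :
    Integrable (fun x => inner ℝ (F x) (G x)) μ := by
  refine (L2.integrable_inner (𝕜 := ℝ) hF.toLp hG.toLp).congr ?_
  filter_upwards [hF.coeFn_toLp, hG.coeFn_toLp] with x h1 h2
  rw [h1, h2]

lemma abs_integral_inner_le {F G : X → V} (hF : MemLp F 2 μ) (hG : MemLp G 2 μ) :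
    |∫ x, inner ℝ (F x) (G x) ∂μ| ≤ (eLpNorm F 2 μ).toReal * (eLpNorm G 2 μ).toReal := by
  have h : ∫ x, inner ℝ (F x) (G x) ∂μ = inner ℝ hF.toLp hG.toLp := by
    rw [L2.inner_def]
    refine integral_congr_ae ?_
    filter_upwards [hF.coeFn_toLp, hG.coeFn_toLp] with x h1 h2
    rw [h1, h2]
  rw [h, ← Lp.norm_toLp F hF, ← Lp.norm_toLp G hG]
  exact abs_real_inner_le_norm _ _

lemma abs_integral_mul_le {F G : X → ℝ} (hF : MemLp F 2 μ) (hG : MemLp G 2 μ) :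
    |∫ x, F x * G x ∂μ| ≤ (eLpNorm F 2 μ).toReal * (eLpNorm G 2 μ).toReal := by
  have := abs_integral_inner_le hF hG
  simpa [mul_comm] using this

lemma sq_toReal_eLpNorm {F : X → V} (hF : MemLp F 2 μ) :
    (eLpNorm F 2 μ).toReal ^ 2 = ∫ x, inner ℝ (F x) (F x) ∂μ := by
  have h : ∫ x, inner ℝ (F x) (F x) ∂μ = inner ℝ hF.toLp hF.toLp := by
    rw [L2.inner_def]
    refine integral_congr_ae ?_
    filter_upwards [hF.coeFn_toLp] with x h1
    rw [h1]
  rw [h, ← Lp.norm_toLp F hF, real_inner_self_eq_norm_sq]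

end L2

/-! ### Test functions and weak gradients -/

lemma IsTestFunction.sub {ψ χ : Plane → ℝ} (hψ : IsTestFunction Ω ψ) (hχ : IsTestFunction Ω χ) :
    IsTestFunction Ω (fun x => ψ x - χ x) :=
  ⟨hψ.1.sub hχ.1, hψ.2.1.sub hχ.2.1,
    (tsupport_sub ψ χ).trans (Set.union_subset hψ.2.2 hχ.2.2)⟩

lemma IsTestFunction.differentiable {ψ : Plane → ℝ} (hψ : IsTestFunction Ω ψ) :
    Differentiable ℝ ψ := hψ.1.differentiable (by simp)

lemma IsTestFunction.continuous_gradient {ψ : Plane → ℝ} (hψ : IsTestFunction Ω ψ) :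
    Continuous (gradient ψ) :=
  (LinearIsometryEquiv.continuous _).comp (hψ.1.continuous_fderiv (by simp))

lemma IsTestFunction.eq_zero {ψ : Plane → ℝ} (hψ : IsTestFunction Ω ψ) {x : Plane}
    (hx : x ∉ Ω) : ψ x = 0 := image_eq_zero_of_notMem_tsupport fun h => hx (hψ.2.2 h)

lemma IsTestFunction.fderiv_eq_zero {ψ : Plane → ℝ} (hψ : IsTestFunction Ω ψ) {x : Plane}
    (hx : x ∉ Ω) : fderiv ℝ ψ x = 0 :=
  fderiv_of_notMem_tsupport ℝ fun h => hx (hψ.2.2 h)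

lemma IsTestFunction.gradient_eq_zero {ψ : Plane → ℝ} (hψ : IsTestFunction Ω ψ) {x : Plane}
    (hx : x ∉ Ω) : gradient ψ x = 0 := by
  simp [gradient, hψ.fderiv_eq_zero hx]

lemma IsTestFunction.hasCompactSupport_gradient {ψ : Plane → ℝ} (hψ : IsTestFunction Ω ψ) :
    HasCompactSupport (gradient ψ) :=
  (hψ.2.1.fderiv (𝕜 := ℝ)).comp_left (map_zero _)

lemma IsTestFunction.memLp {ψ : Plane → ℝ} (hψ : IsTestFunction Ω ψ) (p : ENNReal)
    (μ : Measure Plane) [IsFiniteMeasureOnCompacts μ] : MemLp ψ p μ :=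
  hψ.1.continuous.memLp_of_hasCompactSupport hψ.2.1

lemma IsTestFunction.memLp_gradient {ψ : Plane → ℝ} (hψ : IsTestFunction Ω ψ) (p : ENNReal)
    (μ : Measure Plane) [IsFiniteMeasureOnCompacts μ] : MemLp (gradient ψ) p μ :=
  hψ.continuous_gradient.memLp_of_hasCompactSupport hψ.hasCompactSupport_gradient

lemma inner_gradient {ψ : Plane → ℝ} (x y : Plane) :
    inner ℝ (gradient ψ x) y = fderiv ℝ ψ x y := by
  simp [gradient]

lemma IsTestFunction.gradient_sub {ψ χ : Plane → ℝ} (hψ : IsTestFunction Ω ψ)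
    (hχ : IsTestFunction Ω χ) (x : Plane) :
    gradient (fun x => ψ x - χ x) x = gradient ψ x - gradient χ x := by
  simp [gradient, fderiv_fun_sub hψ.differentiable.differentiableAt
    hχ.differentiable.differentiableAt]

lemma IsTestFunction.integrable_inner_mul {ψ : Plane → ℝ} (hψ : IsTestFunction Ω ψ)
    {G : Plane → Plane} (hG : MemLp G 2 (volume.restrict Ω)) (y : Plane) :
    Integrable (fun x => inner ℝ (G x) y * ψ x) (volume.restrict Ω) :=
  (hG.inner_const y).integrable_mul (hψ.memLp 2 _)

/-- The fundamental lemma of the calculus of variations, applied to one coordinate direction at a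
time. Since `weakGrad` is defined by choice, every later computation of a weak gradient goes through
this uniqueness. -/
lemma HasWeakGrad.ae_eq (hΩ : IsOpen Ω) {u : Plane → ℝ} {G H : Plane → Plane}
    (hG : HasWeakGrad Ω u G) (hH : HasWeakGrad Ω u H) : G =ᵐ[volume.restrict Ω] H := by
  have key : ∀ y : Plane, ∀ᵐ x ∂volume.restrict Ω, inner ℝ (G x - H x) y = 0 := by
    intro y
    rw [ae_restrict_iff' hΩ.measurableSet]
    have hmem : MemLp (fun x => inner ℝ (G x - H x) y) 2 (volume.restrict Ω) :=
      (hG.2.1.sub hH.2.1).inner_const y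
    refine hΩ.ae_eq_zero_of_integral_contDiff_smul_eq_zero ?_ ?_
    · exact (locallyIntegrableOn_of_locallyIntegrable_restrict
        (hmem.locallyIntegrable (by norm_num)))
    · intro ψ h1 h2 h3
      have hψ : IsTestFunction Ω ψ := ⟨h1, h2, h3⟩
      have e1 := hG.2.2 ψ hψ y
      have e2 := hH.2.2 ψ hψ y
      have : ∫ x in Ω, ψ x • inner ℝ (G x - H x) y = 0 := by
        have : ∀ x, ψ x • inner ℝ (G x - H x) y
            = inner ℝ (G x) y * ψ x - inner ℝ (H x) y * ψ x := by
          intro x; rw [inner_sub_left, smul_eq_mul]; ring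
        simp_rw [this]
        rw [integral_sub (hψ.integrable_inner_mul hG.2.1 y) (hψ.integrable_inner_mul hH.2.1 y)]
        linarith
      rw [← this, setIntegral_eq_integral_of_forall_compl_eq_zero]
      intro x hx
      simp [hψ.eq_zero hx]
  filter_upwards [key (EuclideanSpace.single 0 1), key (EuclideanSpace.single 1 1)] with x h0 h1
  ext i
  fin_cases i
  · simpa [EuclideanSpace.inner_single_right, sub_eq_zero] using h0
  · simpa [EuclideanSpace.inner_single_right, sub_eq_zero] using h1

lemma MemH1.hasWeakGrad {u : Plane → ℝ} (hu : MemH1 Ω u) : HasWeakGrad Ω u (weakGrad Ω u) := by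
  rw [weakGrad, dif_pos hu]
  exact hu.choose_spec

lemma HasWeakGrad.weakGrad_ae_eq (hΩ : IsOpen Ω) {u : Plane → ℝ} {G : Plane → Plane}
    (hG : HasWeakGrad Ω u G) : weakGrad Ω u =ᵐ[volume.restrict Ω] G :=
  (MemH1.hasWeakGrad ⟨G, hG⟩).ae_eq hΩ hG

lemma HasWeakGrad.sub {u v : Plane → ℝ} {G H : Plane → Plane}
    (hG : HasWeakGrad Ω u G) (hH : HasWeakGrad Ω v H) :
    HasWeakGrad Ω (fun x => u x - v x) (fun x => G x - H x) := by
  refine ⟨hG.1.sub hH.1, hG.2.1.sub hH.2.1, fun ψ hψ y => ?_⟩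
  have hd : MemLp (fun x => fderiv ℝ ψ x y) 2 (volume.restrict Ω) := by
    simpa only [inner_gradient] using
      (hψ.memLp_gradient 2 (volume.restrict Ω)).inner_const (𝕜 := ℝ) y
  simp_rw [inner_sub_left, sub_mul]
  have hu : Integrable (fun x => u x * fderiv ℝ ψ x y) (volume.restrict Ω) :=
    hG.1.integrable_mul hd
  have hv : Integrable (fun x => v x * fderiv ℝ ψ x y) (volume.restrict Ω) :=
    hH.1.integrable_mul hd
  rw [integral_sub hu hv,
    integral_sub (hψ.integrable_inner_mul hG.2.1 y) (hψ.integrable_inner_mul hH.2.1 y),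
    hG.2.2 ψ hψ y, hH.2.2 ψ hψ y]
  ring

lemma weakGrad_sub_ae_eq (hΩ : IsOpen Ω) {u v : Plane → ℝ} (hu : MemH1 Ω u) (hv : MemH1 Ω v) :
    weakGrad Ω (fun x => u x - v x)
      =ᵐ[volume.restrict Ω] fun x => weakGrad Ω u x - weakGrad Ω v x :=
  (hu.hasWeakGrad.sub hv.hasWeakGrad).weakGrad_ae_eq hΩ

lemma MemH10.memLp {u : Plane → ℝ} (hu : MemH10 Ω u) : MemLp u 2 (volume.restrict Ω) :=
  hu.1.hasWeakGrad.1

lemma MemH10.memLp_weakGrad {u : Plane → ℝ} (hu : MemH10 Ω u) :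
    MemLp (weakGrad Ω u) 2 (volume.restrict Ω) := hu.1.hasWeakGrad.2.1

lemma MemH10.sub (hΩ : IsOpen Ω) {u v : Plane → ℝ} (hu : MemH10 Ω u) (hv : MemH10 Ω v) :
    MemH10 Ω (fun x => u x - v x) := by
  refine ⟨⟨_, hu.1.hasWeakGrad.sub hv.1.hasWeakGrad⟩, fun δ hδ => ?_⟩
  have hδ2 : 0 < δ / 2 := ENNReal.half_pos hδ.ne'
  obtain ⟨ψ, hψ, hψ1, hψ2⟩ := hu.2 _ hδ2
  obtain ⟨χ, hχ, hχ1, hχ2⟩ := hv.2 _ hδ2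
  refine ⟨fun x => ψ x - χ x, hψ.sub hχ, ?_, ?_⟩
  · have : (fun x => u x - v x - (ψ x - χ x)) = (fun x => u x - ψ x) - fun x => v x - χ x := by
      ext x; simp only [Pi.sub_apply]; ring
    rw [this, ← ENNReal.add_halves δ]
    exact (eLpNorm_sub_le (hu.memLp.1.sub (hψ.memLp 2 _).1) (hv.memLp.1.sub (hχ.memLp 2 _).1)
      (by norm_num)).trans_lt (ENNReal.add_lt_add hψ1 hχ1)
  · have : (fun x => weakGrad Ω (fun x => u x - v x) x - gradient (fun x => ψ x - χ x) x)
        =ᵐ[volume.restrict Ω]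
        (fun x => weakGrad Ω u x - gradient ψ x) - fun x => weakGrad Ω v x - gradient χ x := by
      filter_upwards [weakGrad_sub_ae_eq hΩ hu.1 hv.1] with x hx
      rw [hx, hψ.gradient_sub hχ, Pi.sub_apply]
      abel
    rw [eLpNorm_congr_ae this, ← ENNReal.add_halves δ]
    exact (eLpNorm_sub_le (hu.memLp_weakGrad.1.sub (hψ.memLp_gradient 2 _).1)
      (hv.memLp_weakGrad.1.sub (hχ.memLp_gradient 2 _).1)
      (by norm_num)).trans_lt (ENNReal.add_lt_add hψ2 hχ2)

/-! ### Translation estimate and Poincaré inequalities -/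

lemma eLpNorm_two_sq {X V : Type*} [MeasurableSpace X] [NormedAddCommGroup V] (μ : Measure X)
    (F : X → V) : eLpNorm F 2 μ ^ 2 = ∫⁻ x, ‖F x‖ₑ ^ 2 ∂μ := by
  have := eLpNorm_nnreal_pow_eq_lintegral (f := F) (μ := μ) (p := 2) (by norm_num)
  simpa using this

lemma sq_lintegral_le {X : Type*} [MeasurableSpace X] (μ : Measure X) [IsProbabilityMeasure μ]
    {F : X → ENNReal} (hF : AEMeasurable F μ) : (∫⁻ x, F x ∂μ) ^ 2 ≤ ∫⁻ x, F x ^ 2 ∂μ := by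
  have h := ENNReal.lintegral_mul_le_Lp_mul_Lq μ (Real.HolderConjugate.two_two) hF
    (g := fun _ => 1) aemeasurable_const
  simp only [Pi.mul_apply, mul_one, ENNReal.one_rpow, lintegral_const, measure_univ] at h
  calc (∫⁻ x, F x ∂μ) ^ 2 ≤ ((∫⁻ x, F x ^ (2 : ℝ) ∂μ) ^ ((1 : ℝ) / 2)) ^ 2 := by gcongr
    _ = ∫⁻ x, F x ^ 2 ∂μ := by
      rw [← ENNReal.rpow_natCast, ← ENNReal.rpow_mul]
      norm_num

/-- The fundamental theorem of calculus along the segment from `y` to `y + h`, followed by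
Cauchy–Schwarz on the unit interval. -/
lemma IsTestFunction.enorm_sub_sq_le {ψ : Plane → ℝ} (hψ : IsTestFunction Ω ψ) (y h : Plane) :
    ‖ψ (y + h) - ψ y‖ₑ ^ 2
      ≤ ‖h‖ₑ ^ 2 * ∫⁻ t in Set.Ioc (0 : ℝ) 1, ‖gradient ψ (y + t • h)‖ₑ ^ 2 := by
  have hcont : Continuous fun t : ℝ => gradient ψ (y + t • h) :=
    hψ.continuous_gradient.comp (by fun_prop)
  have hd : ∀ t ∈ Set.uIcc (0 : ℝ) 1,
      HasDerivAt (fun t : ℝ => ψ (y + t • h)) (inner ℝ (gradient ψ (y + t • h)) h) t := by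
    intro t _
    rw [inner_gradient]
    have h1 : HasDerivAt (fun t : ℝ => y + t • h) h t := by
      simpa using ((hasDerivAt_id t).smul_const h).const_add y
    exact (hψ.differentiable _).hasFDerivAt.comp_hasDerivAt t h1
  have hint := intervalIntegral.integral_eq_sub_of_hasDerivAt hd
    ((hcont.inner continuous_const).intervalIntegrable _ _)
  simp only [one_smul, zero_smul, add_zero] at hint
  rw [← hint, intervalIntegral.integral_of_le zero_le_one]
  have : IsProbabilityMeasure ((volume : Measure ℝ).restrict (Set.Ioc (0 : ℝ) 1)) :=
    ⟨by simp⟩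
  calc ‖∫ t in Set.Ioc (0 : ℝ) 1, inner ℝ (gradient ψ (y + t • h)) h‖ₑ ^ 2
      ≤ (∫⁻ t in Set.Ioc (0 : ℝ) 1, ‖h‖ₑ * ‖gradient ψ (y + t • h)‖ₑ) ^ 2 := by
        gcongr
        refine (enorm_integral_le_lintegral_enorm _).trans (lintegral_mono fun t => ?_)
        have := norm_inner_le_norm (𝕜 := ℝ) (gradient ψ (y + t • h)) h
        rw [← ofReal_norm, ← ofReal_norm, ← ofReal_norm, ← ENNReal.ofReal_mul (norm_nonneg _)]
        exact ENNReal.ofReal_le_ofReal (by rw [mul_comm]; exact this)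
    _ ≤ ∫⁻ t in Set.Ioc (0 : ℝ) 1, (‖h‖ₑ * ‖gradient ψ (y + t • h)‖ₑ) ^ 2 :=
        sq_lintegral_le _ (by
          have := hcont.enorm.measurable
          exact (this.const_mul _).aemeasurable)
    _ = _ := by
        simp_rw [mul_pow]
        rw [lintegral_const_mul]
        exact (hcont.enorm.measurable).pow_const 2

/-- Integrate the bound on segments over `y` and exchange the integrals: by translation invariance
the integral over `y` no longer depends on `t`. -/
lemma IsTestFunction.eLpNorm_translate_le {ψ : Plane → ℝ} (hψ : IsTestFunction Ω ψ) (h : Plane) :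
    eLpNorm (fun y => ψ (y + h) - ψ y) 2 volume ≤ ‖h‖ₑ * eLpNorm (gradient ψ) 2 volume := by
  refine (ENNReal.pow_le_pow_left_iff (two_ne_zero)).1 ?_
  rw [mul_pow, eLpNorm_two_sq, eLpNorm_two_sq]
  have hm : Measurable fun z : Plane × ℝ => ‖gradient ψ (z.1 + z.2 • h)‖ₑ ^ 2 :=
    ((hψ.continuous_gradient.comp (by fun_prop : Continuous fun z : Plane × ℝ =>
      z.1 + z.2 • h)).enorm.measurable).pow_const 2
  calc ∫⁻ y, ‖ψ (y + h) - ψ y‖ₑ ^ 2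
      ≤ ∫⁻ y, ‖h‖ₑ ^ 2 * ∫⁻ t in Set.Ioc (0 : ℝ) 1, ‖gradient ψ (y + t • h)‖ₑ ^ 2 :=
        lintegral_mono fun y => hψ.enorm_sub_sq_le y h
    _ = ‖h‖ₑ ^ 2 * ∫⁻ y, ∫⁻ t in Set.Ioc (0 : ℝ) 1, ‖gradient ψ (y + t • h)‖ₑ ^ 2 :=
        lintegral_const_mul _ hm.lintegral_prod_right'
    _ = ‖h‖ₑ ^ 2 * ∫⁻ t in Set.Ioc (0 : ℝ) 1, ∫⁻ y, ‖gradient ψ (y + t • h)‖ₑ ^ 2 := by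
        rw [lintegral_lintegral_swap hm.aemeasurable]
    _ = ‖h‖ₑ ^ 2 * ∫⁻ y, ‖gradient ψ y‖ₑ ^ 2 := by
        have : ∀ t : ℝ, ∫⁻ y, ‖gradient ψ (y + t • h)‖ₑ ^ 2 = ∫⁻ y, ‖gradient ψ y‖ₑ ^ 2 :=
          fun t => lintegral_add_right_eq_self (fun y => ‖gradient ψ y‖ₑ ^ 2) (t • h)
        simp [this]

lemma eLpNorm_comp_add_right {V : Type*} [NormedAddCommGroup V] {F : Plane → V}
    (hF : AEStronglyMeasurable F volume) (h : Plane) :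
    eLpNorm (fun y => F (y + h)) 2 volume = eLpNorm F 2 volume :=
  eLpNorm_comp_measurePreserving hF (measurePreserving_add_right volume h)

/-- The extension by zero of a function in `H¹₀(Ω)` satisfies the translation estimate. -/
lemma MemH10.eLpNorm_translate_le (hΩ : IsOpen Ω) {u : Plane → ℝ} (hu : MemH10 Ω u) (h : Plane) :
    eLpNorm (fun y => Ω.indicator u (y + h) - Ω.indicator u y) 2 volume
      ≤ ‖h‖ₑ * eLpNorm (weakGrad Ω u) 2 (volume.restrict Ω) := by
  have hΩm := hΩ.measurableSet
  have hum : AEStronglyMeasurable (Ω.indicator u) volume :=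
    (aestronglyMeasurable_indicator_iff hΩm).2 hu.memLp.1
  -- A test function within `δ` of `u` costs `δ` for each of the two translates and `δ` in the
  -- gradient. The claim is the limit `δ → 0`.
  have htend : Filter.Tendsto (fun δ : ENNReal => 2 * δ
      + ‖h‖ₑ * (eLpNorm (weakGrad Ω u) 2 (volume.restrict Ω) + δ)) (nhdsWithin 0 (Set.Ioi 0))
      (nhds (2 * 0 + ‖h‖ₑ * (eLpNorm (weakGrad Ω u) 2 (volume.restrict Ω) + 0))) := by
    refine Filter.Tendsto.mono_left ?_ nhdsWithin_le_nhds
    refine Filter.Tendsto.add ?_ ?_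
    · exact ENNReal.Tendsto.const_mul Filter.tendsto_id (Or.inr (by simp))
    · exact ENNReal.Tendsto.const_mul (tendsto_const_nhds.add Filter.tendsto_id)
        (Or.inr (by simp))
  simp only [mul_zero, zero_add, add_zero] at htend
  refine ge_of_tendsto htend ?_
  filter_upwards [self_mem_nhdsWithin] with δ hδ
  obtain ⟨ψ, hψ, h1, h2⟩ := hu.2 δ hδ
  have hψm : AEStronglyMeasurable ψ volume := hψ.1.continuous.aestronglyMeasurable
  have hdm : AEStronglyMeasurable (fun y => Ω.indicator u y - ψ y) volume := hum.sub hψm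
  have hd : eLpNorm (fun y => Ω.indicator u y - ψ y) 2 volume ≤ δ := by
    have : (fun y => Ω.indicator u y - ψ y) = Ω.indicator fun y => u y - ψ y := by
      ext y
      by_cases hy : y ∈ Ω
      · simp [hy]
      · simp [hy, hψ.eq_zero hy]
    rw [this, eLpNorm_indicator_eq_eLpNorm_restrict hΩm]
    exact h1.le
  have hg : eLpNorm (gradient ψ) 2 volume
      ≤ eLpNorm (weakGrad Ω u) 2 (volume.restrict Ω) + δ := by
    have : gradient ψ = Ω.indicator (gradient ψ) := by
      ext1 y
      by_cases hy : y ∈ Ω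
      · simp [hy]
      · simp [hy, hψ.gradient_eq_zero hy]
    rw [this, eLpNorm_indicator_eq_eLpNorm_restrict hΩm]
    have h3 : gradient ψ = weakGrad Ω u - fun x => weakGrad Ω u x - gradient ψ x := by
      ext1 y; simp
    calc eLpNorm (gradient ψ) 2 (volume.restrict Ω)
        = eLpNorm (weakGrad Ω u - fun x => weakGrad Ω u x - gradient ψ x) 2
          (volume.restrict Ω) := by rw [← h3]
      _ ≤ _ := (eLpNorm_sub_le hu.memLp_weakGrad.1
          (hu.memLp_weakGrad.1.sub (hψ.memLp_gradient 2 _).1) (by norm_num)).trans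
          (add_le_add le_rfl h2.le)
  have hsplit : (fun y => Ω.indicator u (y + h) - Ω.indicator u y)
      = ((fun y => Ω.indicator u (y + h) - ψ (y + h)) - fun y => Ω.indicator u y - ψ y)
        + fun y => ψ (y + h) - ψ y := by
    ext y; simp only [Pi.add_apply, Pi.sub_apply]; ring
  have hdm' : AEStronglyMeasurable (fun y => Ω.indicator u (y + h) - ψ (y + h)) volume :=
    hdm.comp_measurePreserving (measurePreserving_add_right volume h)
  have hψm' : AEStronglyMeasurable (fun y => ψ (y + h) - ψ y) volume :=
    (hψm.comp_measurePreserving (measurePreserving_add_right volume h)).sub hψm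
  rw [hsplit]
  refine (eLpNorm_add_le (hdm'.sub hdm) hψm' (by norm_num)).trans ?_
  gcongr
  · refine (eLpNorm_sub_le hdm' hdm (by norm_num)).trans ?_
    rw [eLpNorm_comp_add_right hdm h, two_mul]
    gcongr
  · exact (hψ.eLpNorm_translate_le h).trans (by gcongr)

/-- A translation longer than the diameter moves `Ω` off itself, so the difference of the two
translates equals `-u` on `Ω`, and the translation estimate is already the Poincaré inequality. -/
lemma MemH10.l2norm_le_of_isBounded (hΩ : IsOpen Ω) (hb : Bornology.IsBounded Ω) :
    ∃ C : ℝ, 0 ≤ C ∧ ∀ u, MemH10 Ω u → l2norm Ω u ≤ C * l2norm Ω (weakGrad Ω u) := by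
  set h : Plane := EuclideanSpace.single 0 (Metric.diam Ω + 1) with hh
  have hhn : ‖h‖ = Metric.diam Ω + 1 := by
    rw [hh, PiLp.norm_single, Real.norm_eq_abs, abs_of_nonneg]
    positivity [Metric.diam_nonneg (s := Ω)]
  refine ⟨‖h‖, norm_nonneg _, fun u hu => ?_⟩
  have h1 := hu.eLpNorm_translate_le hΩ h
  have h2 : eLpNorm u 2 (volume.restrict Ω)
      ≤ eLpNorm (fun y => Ω.indicator u (y + h) - Ω.indicator u y) 2 volume := by
    rw [← eLpNorm_indicator_eq_eLpNorm_restrict hΩ.measurableSet]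
    refine eLpNorm_mono fun y => ?_
    by_cases hy : y ∈ Ω
    · have : y + h ∉ Ω := by
        intro hy'
        have := Metric.dist_le_diam_of_mem hb hy' hy
        rw [dist_eq_norm, add_sub_cancel_left, hhn] at this
        linarith
      simp [this]
    · simp [hy]
  have h3 := h2.trans h1
  have h4 := ENNReal.toReal_mono (ENNReal.mul_ne_top (by simp) hu.memLp_weakGrad.2.ne) h3
  simpa [l2norm, ENNReal.toReal_mul] using h4

/-- Poincaré inequality on a ball, with the mean replaced by the value at a suitable point of a
smaller ball. -/
lemma MemH10.exists_eLpNorm_sub_le (hΩ : IsOpen Ω) {u : Plane → ℝ} (hu : MemH10 Ω u)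
    {x₀ y₀ : Plane} {R c : ℝ} (hR : 0 < R) (hc : 0 < c)
    (hsub : Metric.closedBall y₀ (c * R) ⊆ Metric.closedBall x₀ R) :
    ∃ y ∈ Metric.closedBall y₀ (c * R),
      eLpNorm (fun x => Ω.indicator u x - Ω.indicator u y) 2
          (volume.restrict (Metric.closedBall x₀ R))
        ≤ ENNReal.ofReal (4 * R / c) * eLpNorm (weakGrad Ω u) 2 (volume.restrict Ω) := by
  set U := Ω.indicator u with hU
  set B := Metric.closedBall x₀ R
  set Z := Metric.closedBall y₀ (c * R) with hZ
  set N := eLpNorm (weakGrad Ω u) 2 (volume.restrict Ω) with hN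
  have hum : AEStronglyMeasurable U volume :=
    (aestronglyMeasurable_indicator_iff hΩ.measurableSet).2 hu.memLp.1
  have hF : AEMeasurable (fun z : Plane × Plane => ‖U (z.1 + z.2) - U z.1‖ₑ ^ 2)
      (volume.prod volume) := by
    have hq : Measure.QuasiMeasurePreserving (fun z : Plane × Plane => z.1 + z.2)
        (volume.prod volume) volume :=
      Measure.quasiMeasurePreserving_snd.comp
        (measurePreserving_prod_add volume volume).quasiMeasurePreserving
    exact (((hum.comp_quasiMeasurePreserving hq).sub
      (hum.comp_quasiMeasurePreserving Measure.quasiMeasurePreserving_fst)).enorm).pow_const 2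
  have hZ0 : volume Z ≠ 0 := (Metric.measure_closedBall_pos volume _ (by positivity)).ne'
  have hZt : volume Z ≠ ⊤ := measure_closedBall_lt_top.ne
  have hI : AEMeasurable (fun y => ∫⁻ k in Metric.closedBall (0 : Plane) (2 * R),
      ‖U (y + k) - U y‖ₑ ^ 2) volume := by
    have h' : AEMeasurable (fun z : Plane × Plane => ‖U (z.1 + z.2) - U z.1‖ₑ ^ 2)
        (volume.prod (volume.restrict (Metric.closedBall (0 : Plane) (2 * R)))) := by
      refine hF.mono_ac ?_
      exact Measure.AbsolutelyContinuous.prod Measure.AbsolutelyContinuous.rfl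
        Measure.restrict_le_self.absolutelyContinuous
    exact h'.lintegral_prod_right'
  -- Some point of `Z` does no worse than the average over `Z`. A point value is preferred to a mean
  -- because it is exactly zero when `Z` lies outside `Ω`.
  obtain ⟨y, hyZ, hy⟩ := exists_le_setLAverage hZ0 hZt hI.restrict
  refine ⟨y, hyZ, ?_⟩
  refine (ENNReal.pow_le_pow_left_iff (two_ne_zero)).1 ?_
  rw [mul_pow, eLpNorm_two_sq]
  have hyB : y ∈ B := hsub hyZ
  -- Substitute `x = y + k`; two points of a ball of radius `R` differ by at most `2R`.
  have h1 : ∫⁻ x in B, ‖U x - U y‖ₑ ^ 2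
      ≤ ∫⁻ k in Metric.closedBall (0 : Plane) (2 * R), ‖U (y + k) - U y‖ₑ ^ 2 := by
    rw [← lintegral_indicator measurableSet_closedBall,
      ← lintegral_indicator measurableSet_closedBall,
      ← lintegral_add_left_eq_self (B.indicator fun x => ‖U x - U y‖ₑ ^ 2) y]
    refine lintegral_mono fun k => ?_
    by_cases hk : y + k ∈ B
    · have : k ∈ Metric.closedBall (0 : Plane) (2 * R) := by
        have := dist_triangle_right (y + k) y x₀
        rw [dist_eq_norm, add_sub_cancel_left] at this
        rw [mem_closedBall_zero_iff]
        have h3 := Metric.mem_closedBall.1 hk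
        have h4 := Metric.mem_closedBall.1 hyB
        linarith
      simp [hk, this]
    · simp [hk]
  refine (h1.trans hy).trans ?_
  rw [setLAverage_eq]
  refine ENNReal.div_le_of_le_mul ?_
  have h2 : ∫⁻ y in Z, ∫⁻ k in Metric.closedBall (0 : Plane) (2 * R), ‖U (y + k) - U y‖ₑ ^ 2
      ≤ ∫⁻ k in Metric.closedBall (0 : Plane) (2 * R), ENNReal.ofReal (2 * R) ^ 2 * N ^ 2 := by
    calc _ ≤ ∫⁻ y, ∫⁻ k in Metric.closedBall (0 : Plane) (2 * R), ‖U (y + k) - U y‖ₑ ^ 2 :=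
          setLIntegral_le_lintegral _ _
      _ = ∫⁻ k in Metric.closedBall (0 : Plane) (2 * R), ∫⁻ y, ‖U (y + k) - U y‖ₑ ^ 2 := by
          refine lintegral_lintegral_swap (hF.mono_ac ?_)
          exact Measure.AbsolutelyContinuous.prod Measure.AbsolutelyContinuous.rfl
            Measure.restrict_le_self.absolutelyContinuous
      _ ≤ _ := by
          refine setLIntegral_mono measurable_const fun k hk => ?_
          rw [← eLpNorm_two_sq, ← mul_pow]
          gcongr
          refine (hu.eLpNorm_translate_le hΩ k).trans ?_
          gcongr
          rw [← ofReal_norm]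
          exact ENNReal.ofReal_le_ofReal (mem_closedBall_zero_iff.1 hk)
  refine h2.trans (le_of_eq ?_)
  rw [setLIntegral_const, hZ, Measure.addHaar_closedBall _ _ (by positivity),
    Measure.addHaar_closedBall _ _ (by positivity), ← ENNReal.ofReal_pow (by positivity),
    ← ENNReal.ofReal_pow (by positivity)]
  -- One factor `(2R)²` comes from the translation estimate, the other from the area of the ball of
  -- shifts; dividing by the area of `Z`, proportional to `(cR)²`, leaves `(4R/c)²`.
  have : ENNReal.ofReal ((2 * R) ^ 2) * ENNReal.ofReal ((2 * R) ^ 2)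
      = ENNReal.ofReal ((4 * R / c) ^ 2) * ENNReal.ofReal ((c * R) ^ 2) := by
    rw [← ENNReal.ofReal_mul (by positivity), ← ENNReal.ofReal_mul (by positivity)]
    congr 1
    field_simp
    ring
  simp only [finrank_euclideanSpace, Fintype.card_fin]
  calc _ = (ENNReal.ofReal ((2 * R) ^ 2) * ENNReal.ofReal ((2 * R) ^ 2)) * N ^ 2
        * volume (Metric.ball (0 : Plane) 1) := by ring
    _ = _ := by rw [this]; ring

/-! ### Exterior balls of Lipschitz domains -/

lemma abs_coord_le_norm (x : Plane) (i : Fin 2) : |x i| ≤ ‖x‖ := by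
  simpa using PiLp.norm_apply_le x i

/-- Small balls centred at boundary points of a Lipschitz domain contain exterior balls of
proportional radius. -/
lemma HasLipschitzBoundary.exists_local (hL : HasLipschitzBoundary Ω) (hΩ : IsOpen Ω)
    {x : Plane} (hx : x ∈ frontier Ω) :
    ∃ c r : ℝ, 0 < c ∧ 0 < r ∧ ∀ z ∈ frontier Ω ∩ Metric.ball x r, ∀ ρ : ℝ, 0 < ρ → ρ ≤ r →
      ∃ y₀, Metric.closedBall y₀ (c * ρ) ⊆ Metric.closedBall z ρ ∩ Ωᶜ := by
  obtain ⟨r, hr, e, K, ψ, hψ, he⟩ := hL x hx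
  have hK : (0 : ℝ) ≤ K := K.2
  -- The ball is centred at distance `ρ/2` straight below `z` in the graph coordinates. Over a
  -- horizontal distance `δ` the graph drops by at most `Kδ`, and `(K + 1)δ = ρ/4 < ρ/2`, so a ball
  -- of radius `δ` stays below the graph.
  refine ⟨1 / (4 * (K + 1)), r / 2, by positivity, by positivity, ?_⟩
  rintro z ⟨hz, hzx⟩ ρ hρ hρr
  have hzΩ : z ∉ Ω := fun h => by
    rw [hΩ.frontier_eq] at hz
    exact hz.2 h
  have hzb : z ∈ Metric.ball x r := Metric.ball_subset_ball (by linarith) hzx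
  have hz1 : e z 1 ≤ ψ (e z 0) := by
    have := mt (he z hzb).2 hzΩ
    exact not_lt.1 this
  set δ : ℝ := 1 / (4 * (K + 1)) * ρ with hδ
  have hδ4 : δ ≤ ρ / 4 := by
    rw [hδ, div_mul_eq_mul_div, one_mul, div_le_div_iff₀ (by positivity) (by norm_num)]
    nlinarith
  have hδK : (K + 1) * δ = ρ / 4 := by
    rw [hδ]; field_simp
  set w : Plane := e z - EuclideanSpace.single 1 (ρ / 2) with hw
  refine ⟨e.symm w, fun y hy => ?_⟩
  have hyw : ‖e y - w‖ ≤ δ := by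
    rw [← dist_eq_norm, ← e.apply_symm_apply w, e.dist_map]
    exact hy
  have hy0 : |e y 0 - e z 0| ≤ δ := by
    have := (abs_coord_le_norm (e y - w) 0).trans hyw
    simpa [hw] using this
  have hy1 : |e y 1 - e z 1 + ρ / 2| ≤ δ := by
    have := (abs_coord_le_norm (e y - w) 1).trans hyw
    simpa [hw, sub_add] using this
  have hyz : dist y z ≤ 3 / 4 * ρ := by
    rw [← e.dist_map]
    calc dist (e y) (e z) ≤ dist (e y) w + dist w (e z) := dist_triangle _ _ _
      _ ≤ ρ / 4 + ρ / 2 := by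
        refine add_le_add ?_ ?_
        · rw [dist_eq_norm]; linarith
        · rw [dist_eq_norm, hw, sub_sub_cancel_left, norm_neg, PiLp.norm_single, Real.norm_eq_abs,
            abs_of_pos (by positivity)]
      _ = _ := by ring
  refine ⟨Metric.mem_closedBall.2 (by linarith), fun hyΩ => ?_⟩
  have hyb : y ∈ Metric.ball x r := by
    rw [Metric.mem_ball] at hzx ⊢
    linarith [dist_triangle y z x]
  have h1 := (he y hyb).1 hyΩ
  have h2 := hψ.dist_le_mul (e z 0) (e y 0)
  rw [Real.dist_eq, Real.dist_eq, abs_sub_comm (e z 0)] at h2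
  have h3 : ψ (e z 0) - ψ (e y 0) ≤ K * δ :=
    (le_abs_self _).trans (h2.trans (mul_le_mul_of_nonneg_left hy0 hK))
  have h4 := (abs_le.1 hy1).2
  nlinarith

/-- Compactness of the boundary reduces to finitely many charts. The radii up to `D` are needed
because the triangles may be as large as the domain, while each chart only handles radii up to its
own `r x`. -/
lemma HasLipschitzBoundary.exists_exterior_ball (hL : HasLipschitzBoundary Ω) (hΩ : IsOpen Ω)
    (hb : Bornology.IsBounded Ω) (D : ℝ) (hD : 0 < D) :
    ∃ c : ℝ, 0 < c ∧ ∀ z ∈ frontier Ω, ∀ R : ℝ, 0 < R → R ≤ D →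
      ∃ y₀, Metric.closedBall y₀ (c * R) ⊆ Metric.closedBall z R ∩ Ωᶜ := by
  have hcomp : IsCompact (frontier Ω) := by
    refine Metric.isCompact_of_isClosed_isBounded isClosed_frontier ?_
    exact hb.closure.subset frontier_subset_closure
  choose! c r hc hr h using fun x (hx : x ∈ frontier Ω) => hL.exists_local hΩ hx
  obtain ⟨t, htf, ht⟩ := hcomp.elim_nhds_subcover (fun x => Metric.ball x (r x))
    fun x hx => Metric.ball_mem_nhds x (hr x hx)
  -- A radius `R` above `r x` is cut down to `r x`, which is still at least `(r x / D) * R` because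
  -- `R ≤ D`.
  obtain ⟨c₀, hc₀, hc₀t⟩ : ∃ c₀ : ℝ, 0 < c₀ ∧ ∀ x ∈ t, c₀ ≤ c x * min 1 (r x / D) := by
    have : ∀ s : Finset Plane, s ⊆ t → ∃ c₀ : ℝ, 0 < c₀ ∧ ∀ x ∈ s, c₀ ≤ c x * min 1 (r x / D) := by
      classical
      intro s
      induction s using Finset.induction_on with
      | empty => exact fun _ => ⟨1, one_pos, by simp⟩
      | insert a s ha ih =>
        intro hs
        obtain ⟨c₀, h0, h1⟩ := ih ((Finset.subset_insert _ _).trans hs)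
        have hat : a ∈ frontier Ω := htf a (hs (Finset.mem_insert_self _ _))
        have : 0 < c a * min 1 (r a / D) :=
          mul_pos (hc a hat) (lt_min one_pos (div_pos (hr a hat) hD))
        refine ⟨min c₀ (c a * min 1 (r a / D)), lt_min h0 this, fun x hx => ?_⟩
        rcases Finset.mem_insert.1 hx with rfl | hx
        · exact min_le_right _ _
        · exact (min_le_left _ _).trans (h1 x hx)
    exact this t subset_rfl
  refine ⟨c₀, hc₀, fun z hz R hR hRD => ?_⟩
  obtain ⟨x, hxt, hzx⟩ := Set.mem_iUnion₂.1 (ht hz)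
  have hxf := htf x hxt
  obtain ⟨y₀, hy₀⟩ := h x hxf z ⟨hz, hzx⟩ (min R (r x)) (lt_min hR (hr x hxf)) (min_le_right _ _)
  refine ⟨y₀, fun y hy => ?_⟩
  have hle : c₀ * R ≤ c x * min R (r x) := by
    refine (mul_le_mul_of_nonneg_right (hc₀t x hxt) hR.le).trans ?_
    rw [mul_assoc]
    refine mul_le_mul_of_nonneg_left ?_ (hc x hxf).le
    rw [min_mul_of_nonneg _ _ hR.le, one_mul]
    refine min_le_min le_rfl ?_
    rw [div_mul_eq_mul_div, div_le_iff₀ hD]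
    exact mul_le_mul_of_nonneg_left hRD (hr x hxf).le
  obtain ⟨h1, h2⟩ := hy₀ (Metric.closedBall_subset_closedBall hle hy)
  exact ⟨Metric.closedBall_subset_closedBall (min_le_left _ _) h1, h2⟩

/-! ### Piecewise Lipschitz functions -/

/-- A function on a real interval that is Lipschitz on each member of a finite closed cover
satisfies the Lipschitz estimate. -/
lemma abs_sub_le_of_closed_cover {ι : Type*} [Finite ι] {F : ℝ → ℝ} {K : ℝ} (hK : 0 ≤ K)
    (S : ι → Set ℝ) (hS : ∀ i, IsClosed (S i)) (hcov : ⋃ i, S i = Set.univ)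
    (hF : ∀ i, ∀ s ∈ S i, ∀ t ∈ S i, |F s - F t| ≤ K * |s - t|) :
    |F 1 - F 0| ≤ K := by
  have hcont : Continuous F := by
    refine (locallyFinite_of_finite S).continuous hcov hS fun i => ?_
    refine (LipschitzOnWith.of_dist_le_mul (K := ⟨K, hK⟩) fun s hs t ht => ?_).continuousOn
    rw [Real.dist_eq, Real.dist_eq]
    exact hF i s hs t ht
  have hclosed : IsClosed {t : ℝ | |F t - F 0| ≤ K * t} :=
    isClosed_le (by fun_prop) (by fun_prop)
  have := (hclosed.inter isClosed_Icc).Icc_subset_of_forall_exists_gt (a := 0) (b := 1) (by simp)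
    (by
      rintro t ⟨ht, ht0, ht1⟩ y hy
      -- Among finitely many sets covering a right neighbourhood of `t`, one has points arbitrarily
      -- close to `t` on the right. Being closed it also contains `t`, so its own Lipschitz bound
      -- carries the estimate beyond `t`.
      have hfreq : ∃ i, ∃ᶠ s in nhdsWithin t (Set.Ioi t), s ∈ S i := by
        by_contra hcon
        push Not at hcon
        have : ∀ᶠ s in nhdsWithin t (Set.Ioi t), ∀ i, s ∉ S i :=
          Filter.eventually_all.2 fun i => hcon i
        obtain ⟨s, hs⟩ := this.exists
        have : s ∈ ⋃ i, S i := hcov ▸ Set.mem_univ s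
        obtain ⟨i, hi⟩ := Set.mem_iUnion.1 this
        exact hs i hi
      obtain ⟨i, hi⟩ := hfreq
      have hti : t ∈ S i := by
        rw [← (hS i).closure_eq, mem_closure_iff_frequently]
        exact hi.filter_mono nhdsWithin_le_nhds
      obtain ⟨s, hs, hsi⟩ := (hi.and_eventually (Ioc_mem_nhdsGT hy)).exists
      refine ⟨s, ?_, hsi⟩
      have h1 := hF i s hs t hti
      rw [abs_of_pos (sub_pos.2 hsi.1)] at h1
      have h2 : |F t - F 0| ≤ K * t := ht
      have h3 := abs_sub_le (F s) (F t) (F 0)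
      simp only [Set.mem_ofPred_eq]
      linarith)
  have h1 := this (Set.right_mem_Icc.2 zero_le_one)
  simpa using h1

/-- A function that is Lipschitz on each member of a finite closed cover of a normed space is
Lipschitz. -/
lemma lipschitzWith_of_closed_cover {E : Type*} [NormedAddCommGroup E] [NormedSpace ℝ E]
    {ι : Type*} [Finite ι] {F : E → ℝ} {K : NNReal}
    (S : ι → Set E) (hS : ∀ i, IsClosed (S i)) (hcov : ⋃ i, S i = Set.univ)
    (hF : ∀ i, LipschitzOnWith K F (S i)) : LipschitzWith K F := by
  refine LipschitzWith.of_dist_le_mul fun x y => ?_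
  have hγ : Continuous fun t : ℝ => y + t • (x - y) := by fun_prop
  have := abs_sub_le_of_closed_cover (F := fun t => F (y + t • (x - y)))
    (K := K * dist x y) (by positivity) (fun i => (fun t : ℝ => y + t • (x - y)) ⁻¹' S i)
    (fun i => (hS i).preimage hγ) (by rw [← Set.preimage_iUnion, hcov, Set.preimage_univ])
    (fun i s hs t ht => by
      have := (hF i).dist_le_mul _ hs _ ht
      rw [Real.dist_eq] at this
      refine this.trans (le_of_eq ?_)
      rw [dist_eq_norm, dist_eq_norm, add_sub_add_left_eq_sub, ← sub_smul, norm_smul,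
        Real.norm_eq_abs]
      ring)
  simpa [Real.dist_eq] using this

/-! ### Measure-theoretic properties of triangulations -/

lemma volume_segment (a b : Plane) : volume (segment ℝ a b) = 0 := by
  refine measure_mono_null (t := (line[ℝ, a, b] : Set Plane)) ?_ ?_
  · rw [← convexHull_pair]
    exact convexHull_subset_affineSpan _
  · refine Measure.addHaar_affineSubspace volume _ fun htop => ?_
    have h1 := collinear_pair ℝ a b
    rw [collinear_iff_finrank_le_one, ← direction_affineSpan, htop, AffineSubspace.direction_top,
      finrank_top, finrank_euclideanSpace] at h1
    simp at h1

lemma IsPolygonalDomain.volume_frontier (hΩ : IsPolygonalDomain Ω) : volume (frontier Ω) = 0 := by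
  obtain ⟨S, hS⟩ := hΩ.polygonal
  rw [hS]
  exact (measure_biUnion_null_iff S.countable_toSet).2 fun s _ => volume_segment _ _

/-- The triangles cover `closure Ω` while the norms live on `Ω`; a boundary made of finitely many
segments is null, so the difference is invisible. -/
lemma IsPolygonalDomain.restrict_closure (hΩ : IsPolygonalDomain Ω) :
    (volume : Measure Plane).restrict (closure Ω) = volume.restrict Ω := by
  refine Measure.restrict_congr_set ?_
  have h : (closure Ω \ Ω : Set Plane) =ᵐ[volume] (∅ : Set Plane) := by
    rw [← hΩ.isOpen.frontier_eq]
    exact ae_eq_empty.2 hΩ.volume_frontier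
  have := (ae_eq_refl Ω).union h
  rwa [Set.union_sdiff_cancel subset_closure, Set.union_empty] at this

lemma isFiniteMeasure_restrict_of_isBounded (hb : Bornology.IsBounded Ω) :
    IsFiniteMeasure ((volume : Measure Plane).restrict Ω) :=
  isFiniteMeasure_restrict.2 hb.measure_lt_top.ne

lemma isCompact_tri (t : Finset Plane) : IsCompact (tri t) :=
  t.finite_toSet.isCompact_convexHull ℝ

lemma isClosed_tri (t : Finset Plane) : IsClosed (tri t) := (isCompact_tri t).isClosed

lemma convex_tri (t : Finset Plane) : Convex ℝ (tri t) := convex_convexHull ℝ _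

lemma mem_tri {t : Finset Plane} {z : Plane} (hz : z ∈ t) : z ∈ tri t :=
  subset_convexHull ℝ _ hz

lemma dist_le_cellDiam {t : Finset Plane} {x y : Plane} (hx : x ∈ tri t) (hy : y ∈ tri t) :
    dist x y ≤ cellDiam t :=
  Metric.dist_le_diam_of_mem (isCompact_tri t).isBounded hx hy

namespace Triangulation

lemma tri_subset (T : Triangulation Ω) {t : Finset Plane} (ht : t ∈ T.cells) :
    tri t ⊆ closure Ω := by
  rw [← T.cover]
  exact Set.subset_biUnion_of_mem (u := fun t : Finset Plane => convexHull ℝ (t : Set Plane)) ht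

lemma exists_mem_tri (T : Triangulation Ω) {x : Plane} (hx : x ∈ closure Ω) :
    ∃ t ∈ T.cells, x ∈ tri t := by
  rw [← T.cover] at hx
  simpa [tri] using hx

lemma ae_exists_mem_interior (T : Triangulation Ω) (hΩ : IsOpen Ω) :
    ∀ᵐ x ∂(volume : Measure Plane).restrict Ω, ∃ t ∈ T.cells, x ∈ interior (tri t) := by
  have h : ∀ᵐ x ∂(volume : Measure Plane), ∀ t ∈ T.cells, x ∉ frontier (tri t) := by
    rw [Finset.eventually_all]
    intro t _
    exact measure_eq_zero_iff_ae_notMem.1 ((convex_tri t).addHaar_frontier volume)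
  rw [ae_restrict_iff' hΩ.measurableSet]
  filter_upwards [h] with x hx hxΩ
  obtain ⟨t, ht, hxt⟩ := T.exists_mem_tri (subset_closure hxΩ)
  refine ⟨t, ht, ?_⟩
  by_contra hcon
  exact hx t ht ⟨subset_closure hxt, hcon⟩

/-- Distinct triangles share at most two vertices, so by conformity their intersection lies in an
affine subspace of dimension at most one. -/
lemma volume_tri_inter (T : Triangulation Ω) {s t : Finset Plane} (hs : s ∈ T.cells)
    (ht : t ∈ T.cells) (hst : s ≠ t) : volume (tri s ∩ tri t) = 0 := by
  classical
  have hcard : (s ∩ t).card ≤ 2 := by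
    by_contra hcon
    have h1 : s ∩ t = s := Finset.eq_of_subset_of_card_le Finset.inter_subset_left (by
      rw [T.card_eq s hs]; omega)
    have h2 : s ∩ t = t := Finset.eq_of_subset_of_card_le Finset.inter_subset_right (by
      rw [T.card_eq t ht]; omega)
    exact hst (h1.symm.trans h2)
  have hsub : tri s ∩ tri t ⊆ (affineSpan ℝ ((s ∩ t : Finset Plane) : Set Plane) : Set Plane) := by
    rw [tri, tri, T.inter s hs t ht, ← Finset.coe_inter]
    exact convexHull_subset_affineSpan _
  refine measure_mono_null hsub (Measure.addHaar_affineSubspace volume _ fun htop => ?_)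
  have h1 : Module.finrank ℝ (vectorSpan ℝ ((s ∩ t : Finset Plane) : Set Plane)) = 2 := by
    rw [← direction_affineSpan, htop, AffineSubspace.direction_top, finrank_top,
      finrank_euclideanSpace, Fintype.card_fin]
  have h2 := finrank_vectorSpan_image_finset_le ℝ (id : Plane → Plane) (s ∩ t) (n := 1)
  rcases Nat.lt_or_ge (s ∩ t).card 2 with h | h
  · have hsing : (((s ∩ t : Finset Plane) : Set Plane)).Subsingleton := by
      intro a ha b hb
      exact Finset.card_le_one.1 (by omega) a ha b hb
    have : vectorSpan ℝ ((s ∩ t : Finset Plane) : Set Plane) = ⊥ :=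
      (vectorSpan_eq_bot_iff_subsingleton ℝ).2 hsing
    rw [this] at h1
    simp at h1
  · have := h2 (by omega)
    rw [Finset.image_id] at this
    omega

lemma restrict_eq_sum (T : Triangulation Ω) (hΩ : IsPolygonalDomain Ω) :
    (volume : Measure Plane).restrict Ω = ∑ t ∈ T.cells, volume.restrict (tri t) := by
  have hcov : closure Ω = ⋃ t : T.cells, tri t := by
    rw [← T.cover, Set.iUnion_subtype]
    rfl
  rw [← hΩ.restrict_closure, hcov, Measure.restrict_iUnion_ae, Measure.sum_fintype]
  · exact Finset.sum_coe_sort T.cells fun t => (volume : Measure Plane).restrict (tri t)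
  · intro s t hst
    exact T.volume_tri_inter s.2 t.2 fun h => hst (Subtype.ext h)
  · exact fun t => (isClosed_tri _).measurableSet.nullMeasurableSet

lemma restrict_tri_le (T : Triangulation Ω) (hΩ : IsPolygonalDomain Ω) {t : Finset Plane}
    (ht : t ∈ T.cells) : (volume : Measure Plane).restrict (tri t) ≤ volume.restrict Ω := by
  rw [← hΩ.restrict_closure]
  exact Measure.restrict_mono_set _ (T.tri_subset ht)

/-- The integral over the domain is the sum of the integrals over the triangles. -/
lemma integral_eq_sum (T : Triangulation Ω) (hΩ : IsPolygonalDomain Ω) {F : Plane → ℝ}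
    (hF : Integrable F (volume.restrict Ω)) :
    ∫ x in Ω, F x = ∑ t ∈ T.cells, ∫ x in tri t, F x := by
  rw [T.restrict_eq_sum hΩ, integral_finsetSum_measure]
  exact fun t ht => hF.mono_measure (T.restrict_tri_le hΩ ht)

/-! ### Piecewise affine functions -/

/-- Functions that are affine on each closed triangle. -/
def IsPiecewiseAffine (T : Triangulation Ω) (u : Plane → ℝ) : Prop :=
  ∀ t ∈ T.cells, ∃ l : Plane →ᵃ[ℝ] ℝ, Set.EqOn u l (tri t)

end Triangulation

lemma contDiff_affineMap (l : Plane →ᵃ[ℝ] ℝ) : ContDiff ℝ ∞ l := by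
  have h : (l : Plane → ℝ) = fun x => l.linear.toContinuousLinearMap x + l 0 := by
    ext x
    exact congrFun (AffineMap.decomp l) x
  rw [h]
  exact (ContinuousLinearMap.contDiff _).add contDiff_const

lemma fderiv_affineMap (l : Plane →ᵃ[ℝ] ℝ) (x : Plane) :
    fderiv ℝ l x = l.linear.toContinuousLinearMap := by
  have h : (l : Plane → ℝ) = fun x => l.linear.toContinuousLinearMap x + l 0 := by
    ext x
    exact congrFun (AffineMap.decomp l) x
  rw [h, fderiv_add_const, ContinuousLinearMap.fderiv]

lemma differentiable_affineMap (l : Plane →ᵃ[ℝ] ℝ) : Differentiable ℝ l :=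
  (contDiff_affineMap l).differentiable (by simp)

lemma eventuallyEq_of_mem_interior {u v : Plane → ℝ} {S : Set Plane} (h : Set.EqOn u v S)
    {x : Plane} (hx : x ∈ interior S) : u =ᶠ[nhds x] v :=
  Filter.eventuallyEq_of_mem (mem_interior_iff_mem_nhds.1 hx) h

namespace Triangulation

variable {T : Triangulation Ω} {u : Plane → ℝ}

lemma IsPiecewiseAffine.exists_bound (hu : T.IsPiecewiseAffine u) :
    ∃ C : ℝ, ∀ x ∈ closure Ω, |u x| ≤ C := by
  have h : ∀ t ∈ T.cells, ∃ C : ℝ, ∀ x ∈ tri t, |u x| ≤ C := by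
    intro t ht
    obtain ⟨l, hl⟩ := hu t ht
    obtain ⟨C, hC⟩ := (isCompact_tri t).exists_bound_of_continuousOn
      (contDiff_affineMap l).continuous.continuousOn
    exact ⟨C, fun x hx => by rw [hl hx]; exact hC x hx⟩
  choose! C hC using h
  refine ⟨∑ t ∈ T.cells, |C t|, fun x hx => ?_⟩
  obtain ⟨t, ht, hxt⟩ := T.exists_mem_tri hx
  exact ((hC t ht x hxt).trans (le_abs_self _)).trans
    (Finset.single_le_sum (f := fun t => |C t|) (fun _ _ => abs_nonneg _) ht)

lemma IsPiecewiseAffine.exists_gradient_bound (hu : T.IsPiecewiseAffine u) :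
    ∃ C : ℝ, ∀ t ∈ T.cells, ∀ x ∈ interior (tri t), ‖fderiv ℝ u x‖ ≤ C := by
  choose! l hl using hu
  refine ⟨∑ t ∈ T.cells, ‖(l t).linear.toContinuousLinearMap‖, fun t ht x hx => ?_⟩
  rw [(eventuallyEq_of_mem_interior (hl t ht) hx).fderiv_eq, fderiv_affineMap]
  exact Finset.single_le_sum (f := fun t => ‖(l t).linear.toContinuousLinearMap‖)
    (fun _ _ => norm_nonneg _) ht

lemma IsPiecewiseAffine.differentiableAt (hu : T.IsPiecewiseAffine u) {t : Finset Plane}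
    (ht : t ∈ T.cells) {x : Plane} (hx : x ∈ interior (tri t)) : DifferentiableAt ℝ u x := by
  obtain ⟨l, hl⟩ := hu t ht
  exact (eventuallyEq_of_mem_interior hl hx).differentiableAt_iff.2
    (differentiable_affineMap l x)

lemma IsPiecewiseAffine.ae_differentiableAt (hu : T.IsPiecewiseAffine u) (hΩ : IsOpen Ω) :
    ∀ᵐ x ∂(volume : Measure Plane).restrict Ω, DifferentiableAt ℝ u x := by
  filter_upwards [T.ae_exists_mem_interior hΩ] with x ⟨t, ht, hx⟩
  exact hu.differentiableAt ht hx

lemma IsPiecewiseAffine.aestronglyMeasurable (hu : T.IsPiecewiseAffine u) :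
    AEStronglyMeasurable u ((volume : Measure Plane).restrict Ω) := by
  have h : AEStronglyMeasurable u
      ((volume : Measure Plane).restrict (⋃ t : T.cells, tri t)) := by
    refine aestronglyMeasurable_iUnion_iff.2 fun t => ?_
    obtain ⟨l, hl⟩ := hu t t.2
    refine ((contDiff_affineMap l).continuous.aestronglyMeasurable).congr ?_
    filter_upwards [ae_restrict_mem (isClosed_tri _).measurableSet] with x hx
    exact (hl hx).symm
  refine h.mono_set fun x hx => ?_
  obtain ⟨t, ht, hxt⟩ := T.exists_mem_tri (subset_closure hx)
  exact Set.mem_iUnion.2 ⟨⟨t, ht⟩, hxt⟩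

lemma IsPiecewiseAffine.memLp (hu : T.IsPiecewiseAffine u) (hΩ : IsOpen Ω)
    (hb : Bornology.IsBounded Ω) (p : ENNReal) : MemLp u p (volume.restrict Ω) := by
  have := isFiniteMeasure_restrict_of_isBounded hb
  obtain ⟨C, hC⟩ := hu.exists_bound
  refine MemLp.of_bound hu.aestronglyMeasurable C ?_
  filter_upwards [ae_restrict_mem hΩ.measurableSet] with x hx
  exact hC x (subset_closure hx)

lemma measurable_gradient (u : Plane → ℝ) : Measurable (gradient u) :=
  (LinearIsometryEquiv.continuous _).measurable.comp (measurable_fderiv ℝ u)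

lemma IsPiecewiseAffine.memLp_gradient (hu : T.IsPiecewiseAffine u) (hΩ : IsOpen Ω)
    (hb : Bornology.IsBounded Ω) (p : ENNReal) : MemLp (gradient u) p (volume.restrict Ω) := by
  have := isFiniteMeasure_restrict_of_isBounded hb
  obtain ⟨C, hC⟩ := hu.exists_gradient_bound
  refine MemLp.of_bound (measurable_gradient u).aestronglyMeasurable C ?_
  filter_upwards [T.ae_exists_mem_interior hΩ] with x ⟨t, ht, hx⟩
  rw [gradient, LinearIsometryEquiv.norm_map]
  exact hC t ht x hx

/-- Lipschitz continuity of functions that vanish outside `Ω` and agree on each triangle with a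
Lipschitz function. -/
lemma exists_lipschitzWith (T : Triangulation Ω) (hΩ : IsOpen Ω) {F : Plane → ℝ}
    (h0 : ∀ x ∉ Ω, F x = 0) (h : ∀ t ∈ T.cells, ∃ K, LipschitzOnWith K F (tri t)) :
    ∃ K, LipschitzWith K F := by
  choose! K hK using h
  -- The complement of `Ω`, where `F` is zero, joins the triangles as one more closed set; this
  -- takes care of segments that leave the domain.
  refine ⟨∑ t ∈ T.cells, K t, lipschitzWith_of_closed_cover
    (fun i : Option T.cells => i.elim Ωᶜ fun t => tri t) ?_ ?_ ?_⟩
  · rintro (_ | t)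
    · exact hΩ.isClosed_compl
    · exact isClosed_tri _
  · refine Set.eq_univ_of_forall fun x => ?_
    by_cases hx : x ∈ Ω
    · obtain ⟨t, ht, hxt⟩ := T.exists_mem_tri (subset_closure hx)
      exact Set.mem_iUnion.2 ⟨some ⟨t, ht⟩, hxt⟩
    · exact Set.mem_iUnion.2 ⟨none, hx⟩
  · rintro (_ | t)
    · intro x hx y hy
      rw [h0 x hx, h0 y hy, edist_self]
      exact zero_le
    · exact (hK t t.2).weaken (Finset.single_le_sum (f := K) (fun _ _ => zero_le) t.2)

/-- A piecewise affine function has its pointwise gradient as weak gradient. -/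
lemma IsPiecewiseAffine.hasWeakGrad (hu : T.IsPiecewiseAffine u) (hΩ : IsOpen Ω)
    (hb : Bornology.IsBounded Ω) : HasWeakGrad Ω u (gradient u) := by
  refine ⟨hu.memLp hΩ hb 2, hu.memLp_gradient hΩ hb 2, fun ψ hψ y => ?_⟩
  -- `u` may be arbitrary outside `Ω`, but its product with a test function is Lipschitz on the
  -- whole plane.
  set F : Plane → ℝ := fun x => u x * ψ x with hF
  have hFc : HasCompactSupport F := hψ.2.1.mul_left
  obtain ⟨K, hK⟩ : ∃ K, LipschitzWith K F := by
    refine T.exists_lipschitzWith hΩ (fun x hx => by simp [hF, hψ.eq_zero hx]) fun t ht => ?_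
    obtain ⟨l, hl⟩ := hu t ht
    have h1 : ContDiff ℝ ∞ fun x => l x * ψ x := (contDiff_affineMap l).mul hψ.1
    obtain ⟨K, hK⟩ := h1.lipschitzWith_of_hasCompactSupport hψ.2.1.mul_left (by simp)
    refine ⟨K, fun x hx z hz => ?_⟩
    simp only [hF]
    rw [hl hx, hl hz]
    exact hK x z
  -- Integration by parts against the constant `1`: the directional derivative of the compactly
  -- supported `F` has integral zero. The product rule, valid almost everywhere, then gives the weak
  -- gradient.
  have h0 := LipschitzWith.integral_lineDeriv_mul_eq (μ := (volume : Measure Plane))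
    (LipschitzWith.const (1 : ℝ)) hK hFc (-y)
  simp only [neg_neg, mul_one] at h0
  have hc : ∀ x, lineDeriv ℝ (fun _ : Plane => (1 : ℝ)) x (-y) = 0 := by
    intro x; simp [lineDeriv]
  simp only [hc, zero_mul, integral_zero] at h0
  have hsupp : ∀ x ∉ Ω, lineDeriv ℝ F x y = 0 := by
    intro x hx
    have hx' : x ∉ tsupport F := fun h => hx (hψ.2.2 (closure_mono
      (Function.support_mul_subset_right u ψ) h))
    have h1 : F =ᶠ[nhds x] 0 := notMem_tsupport_iff_eventuallyEq.1 hx'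
    rw [h1.lineDeriv_eq]
    simp [lineDeriv]
  rw [← setIntegral_eq_integral_of_forall_compl_eq_zero hsupp] at h0
  have hae : ∀ᵐ x ∂(volume : Measure Plane).restrict Ω, lineDeriv ℝ F x y
      = u x * fderiv ℝ ψ x y + inner ℝ (gradient u x) y * ψ x := by
    filter_upwards [hu.ae_differentiableAt hΩ] with x hx
    have h1 : HasFDerivAt F _ x := hx.hasFDerivAt.mul (hψ.differentiable x).hasFDerivAt
    rw [h1.differentiableAt.lineDeriv_eq_fderiv, h1.fderiv, inner_gradient]
    simp [mul_comm]
  have hd : MemLp (fun x => fderiv ℝ ψ x y) 2 (volume.restrict Ω) := by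
    simpa only [inner_gradient] using
      (hψ.memLp_gradient 2 (volume.restrict Ω)).inner_const (𝕜 := ℝ) y
  have hi : Integrable (fun x => u x * fderiv ℝ ψ x y) (volume.restrict Ω) :=
    (hu.memLp hΩ hb 2).integrable_mul hd
  rw [integral_congr_ae hae,
    integral_add hi (hψ.integrable_inner_mul (hu.memLp_gradient hΩ hb 2) y)] at h0
  linarith

end Triangulation

/-! ### Truncation and mollification -/

lemma tendsto_eLpNorm_two_zero {X V : Type*} [MeasurableSpace X] [NormedAddCommGroup V]
    {μ : Measure X} [IsFiniteMeasure μ] {F : ℕ → X → V} (C : ℝ)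
    (hm : ∀ m, AEStronglyMeasurable (F m) μ) (hb : ∀ m, ∀ᵐ x ∂μ, ‖F m x‖ ≤ C)
    (hlim : ∀ᵐ x ∂μ, Filter.Tendsto (fun m => F m x) Filter.atTop (nhds 0)) :
    Filter.Tendsto (fun m => eLpNorm (F m) 2 μ) Filter.atTop (nhds 0) := by
  have h1 : Filter.Tendsto (fun m => ∫⁻ x, ‖F m x‖ₑ ^ 2 ∂μ) Filter.atTop
      (nhds (∫⁻ _, 0 ∂μ)) := by
    refine tendsto_lintegral_of_dominated_convergence' (fun _ => ENNReal.ofReal C ^ 2)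
      (fun m => (hm m).enorm.pow_const 2) (fun m => ?_) ?_ ?_
    · filter_upwards [hb m] with x hx
      gcongr
      rw [← ofReal_norm]
      exact ENNReal.ofReal_le_ofReal hx
    · rw [lintegral_const]
      exact ENNReal.mul_ne_top (by simp) (measure_ne_top _ _)
    · filter_upwards [hlim] with x hx
      have := (ENNReal.continuous_pow 2).tendsto _ |>.comp hx.enorm
      simpa [Function.comp_def] using this
  simp_rw [← eLpNorm_two_sq, lintegral_zero] at h1
  have h2 := (ENNReal.continuous_rpow_const (y := (2⁻¹ : ℝ))).tendsto 0 |>.comp h1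
  have h3 : ∀ a : ENNReal, (a ^ 2) ^ (2⁻¹ : ℝ) = a := by
    intro a
    rw [← ENNReal.rpow_natCast, ← ENNReal.rpow_mul]
    norm_num
  simpa [Function.comp_def, h3] using h2

/-- Soft thresholding at level `δ`. -/
def truncate (δ s : ℝ) : ℝ := max (s - δ) 0 + min (s + δ) 0

/-- The constant `2` is the sum of the constants of the two summands; it is not sharp, but any fixed
constant serves. -/
lemma truncate_lipschitz (δ : ℝ) : LipschitzWith 2 (truncate δ) := by
  have h1 : LipschitzWith 1 fun s : ℝ => max (s - δ) 0 :=
    (LipschitzWith.of_dist_le' (K := 1) (by simp [Real.dist_eq])).max_const 0 |>.weaken (by simp)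
  have h2 : LipschitzWith 1 fun s : ℝ => min (s + δ) 0 :=
    (LipschitzWith.of_dist_le' (K := 1) (by simp [Real.dist_eq])).min_const 0 |>.weaken (by simp)
  have := h1.add h2
  norm_num at this
  exact this

lemma truncate_of_le {δ s : ℝ} (hδ : 0 < δ) (h : δ ≤ s) : truncate δ s = s - δ := by
  rw [truncate, max_eq_left (by linarith), min_eq_right (by linarith), add_zero]

lemma truncate_of_le_neg {δ s : ℝ} (hδ : 0 < δ) (h : s ≤ -δ) : truncate δ s = s + δ := by
  rw [truncate, max_eq_right (by linarith), min_eq_left (by linarith), zero_add]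

lemma truncate_of_abs_le {δ s : ℝ} (h : |s| ≤ δ) : truncate δ s = 0 := by
  obtain ⟨h1, h2⟩ := abs_le.1 h
  rw [truncate, max_eq_right (by linarith), min_eq_right (by linarith), zero_add]

lemma abs_sub_truncate_le {δ : ℝ} (hδ : 0 < δ) (s : ℝ) : |s - truncate δ s| ≤ δ := by
  rcases le_or_gt |s| δ with h | h
  · rwa [truncate_of_abs_le h, sub_zero]
  · rcases lt_abs.1 h with h | h
    · rw [truncate_of_le hδ h.le, sub_sub_cancel, abs_of_pos hδ]
    · rw [truncate_of_le_neg hδ (by linarith), sub_add_cancel_left, abs_neg, abs_of_pos hδ]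

/-- A bump function at the origin with support in the ball of radius `ρ`. -/
def bumpOfRadius (ρ : ℝ) (hρ : 0 < ρ) : ContDiffBump (0 : Plane) :=
  ⟨ρ / 2, ρ, by positivity, by linarith⟩

/-- The mollification of `v` at scale `ρ`. -/
def mollify (ρ : ℝ) (hρ : 0 < ρ) (v : Plane → ℝ) (x : Plane) : ℝ :=
  ∫ t, (bumpOfRadius ρ hρ).normed volume t * v (x - t)

section Mollify

variable {ρ : ℝ} (hρ : 0 < ρ) {v : Plane → ℝ}

lemma mollify_eq_convolution (v : Plane → ℝ) : mollify ρ hρ v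
    = convolution ((bumpOfRadius ρ hρ).normed volume) v (ContinuousLinearMap.lsmul ℝ ℝ) volume := by
  ext x
  simp [mollify, convolution]

lemma contDiff_mollify (hv : Continuous v) : ContDiff ℝ ∞ (mollify ρ hρ v) := by
  rw [mollify_eq_convolution]
  exact (bumpOfRadius ρ hρ).hasCompactSupport_normed.contDiff_convolution_left _
    (bumpOfRadius ρ hρ).contDiff_normed hv.locallyIntegrable

lemma normed_bump_eq_zero {t : Plane} (ht : ρ ≤ ‖t‖) :
    (bumpOfRadius ρ hρ).normed volume t = 0 := by
  have : t ∉ Function.support ((bumpOfRadius ρ hρ).normed volume) := by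
    rw [ContDiffBump.support_normed_eq, mem_ball_zero_iff]
    exact not_lt.2 ht
  simpa using this

lemma integrable_mollify (hv : Continuous v) (x : Plane) :
    Integrable fun t => (bumpOfRadius ρ hρ).normed volume t * v (x - t) := by
  refine Continuous.integrable_of_hasCompactSupport ?_
    (bumpOfRadius ρ hρ).hasCompactSupport_normed.mul_right
  exact (bumpOfRadius ρ hρ).continuous_normed.mul (by fun_prop)

lemma mollify_congr {w : Plane → ℝ} {x : Plane} (h : ∀ y, dist y x < ρ → v y = w y) :
    mollify ρ hρ v x = mollify ρ hρ w x := by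
  refine integral_congr_ae (Filter.Eventually.of_forall fun t => ?_)
  dsimp only
  by_cases ht : ρ ≤ ‖t‖
  · simp [normed_bump_eq_zero hρ ht]
  · rw [h (x - t)]
    rw [dist_eq_norm, sub_sub_cancel_left, norm_neg]
    exact not_le.1 ht

lemma mollify_zero (x : Plane) : mollify ρ hρ (fun _ => 0) x = 0 := by simp [mollify]

/-- The bump is even, so the values at `x - t` and `x + t` carry the same weight, and for an affine
function they average to the value at `x`. -/
lemma mollify_affineMap (l : Plane →ᵃ[ℝ] ℝ) (x : Plane) : mollify ρ hρ l x = l x := by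
  have hc := (contDiff_affineMap l).continuous
  have h1 : mollify ρ hρ l x = ∫ t, (bumpOfRadius ρ hρ).normed volume t * l (x + t) := by
    rw [mollify, ← integral_neg_eq_self]
    simp [ContDiffBump.normed_neg, sub_neg_eq_add]
  have h2 : Integrable fun t => (bumpOfRadius ρ hρ).normed volume t * l (x + t) := by
    refine Continuous.integrable_of_hasCompactSupport ?_
      (bumpOfRadius ρ hρ).hasCompactSupport_normed.mul_right
    exact (bumpOfRadius ρ hρ).continuous_normed.mul (by fun_prop)
  have h3 : ∀ t : Plane, l (x - t) + l (x + t) = 2 * l x := by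
    intro t
    have e1 : l (x - t) = l.linear (-t) + l x := by
      rw [sub_eq_neg_add]; exact l.map_vadd x (-t)
    have e2 : l (x + t) = l.linear t + l x := by
      rw [add_comm]; exact l.map_vadd x t
    rw [e1, e2, map_neg]; ring
  have h4 : mollify ρ hρ l x + mollify ρ hρ l x = 2 * l x := by
    nth_rw 2 [h1]
    rw [mollify, ← integral_add (integrable_mollify hρ hc x) h2]
    simp_rw [← mul_add, h3]
    rw [integral_mul_const, ContDiffBump.integral_normed, one_mul]
  linarith

lemma abs_mollify_sub_le {K : NNReal} (hv : LipschitzWith K v) (x y : Plane) :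
    |mollify ρ hρ v x - mollify ρ hρ v y| ≤ K * dist x y := by
  rw [mollify, mollify, ← integral_sub (integrable_mollify hρ hv.continuous x)
    (integrable_mollify hρ hv.continuous y), ← Real.norm_eq_abs]
  have h := norm_integral_le_of_norm_le (μ := (volume : Measure Plane))
    (f := fun t => (bumpOfRadius ρ hρ).normed volume t * v (x - t)
      - (bumpOfRadius ρ hρ).normed volume t * v (y - t))
    (g := fun t => (bumpOfRadius ρ hρ).normed volume t * (K * dist x y))
    ((bumpOfRadius ρ hρ).integrable_normed.mul_const _)
    (Filter.Eventually.of_forall fun t => by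
      rw [← mul_sub, norm_mul, Real.norm_of_nonneg (ContDiffBump.nonneg_normed _ t)]
      refine mul_le_mul_of_nonneg_left ?_ (ContDiffBump.nonneg_normed _ t)
      have := hv.dist_le_mul (x - t) (y - t)
      rwa [Real.dist_eq, dist_sub_right] at this)
  rwa [integral_mul_const, ContDiffBump.integral_normed, one_mul] at h

lemma abs_mollify_sub_self_le {K : NNReal} (hv : LipschitzWith K v) (x : Plane) :
    |mollify ρ hρ v x - v x| ≤ K * ρ := by
  have := (bumpOfRadius ρ hρ).dist_normed_convolution_le (μ := (volume : Measure Plane)) (g := v)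
    (x₀ := x) (ε := K * ρ) hv.continuous.aestronglyMeasurable (fun y hy => by
      refine (hv.dist_le_mul y x).trans ?_
      gcongr
      exact (Metric.mem_ball.1 hy).le)
  rwa [← mollify_eq_convolution, Real.dist_eq] at this

end Mollify

lemma volume_affineMap_zero {l : Plane →ᵃ[ℝ] ℝ} {a : Plane} (ha : l a ≠ 0) :
    volume {x : Plane | l x = 0} = 0 := by
  have h : {x : Plane | l x = 0} = ((AffineSubspace.mk' (0 : ℝ) ⊥).comap l : Set Plane) := by
    ext x
    simp [AffineSubspace.mem_mk']
  rw [h]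
  refine Measure.addHaar_affineSubspace volume _ fun htop => ha ?_
  have : a ∈ (AffineSubspace.mk' (0 : ℝ) ⊥).comap l := htop ▸ AffineSubspace.mem_top ℝ Plane a
  simpa [AffineSubspace.mem_mk'] using this

namespace Triangulation

variable {T : Triangulation Ω} {u : Plane → ℝ}

lemma IsPiecewiseAffine.exists_lipschitzWith (hu : T.IsPiecewiseAffine u) (hΩ : IsOpen Ω)
    (h0 : ∀ x ∉ Ω, u x = 0) : ∃ K, LipschitzWith K u := by
  refine T.exists_lipschitzWith hΩ h0 fun t ht => ?_
  obtain ⟨l, hl⟩ := hu t ht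
  refine ⟨‖l.linear.toContinuousLinearMap‖₊, fun x hx y hy => ?_⟩
  rw [hl hx, hl hy]
  have h : LipschitzWith ‖l.linear.toContinuousLinearMap‖₊ l :=
    lipschitzWith_of_nnnorm_fderiv_le (𝕜 := ℝ) (differentiable_affineMap l)
      fun x => by rw [fderiv_affineMap]
  exact h x y

/-- Almost everywhere, the truncations at a small level of a piecewise affine function are affine in
a fixed neighbourhood, with the same gradient. -/
lemma IsPiecewiseAffine.ae_truncate (hu : T.IsPiecewiseAffine u) (hΩ : IsOpen Ω) :
    ∀ᵐ x ∂(volume : Measure Plane).restrict Ω, ∃ r : ℝ, 0 < r ∧ ∀ δ : ℝ, 0 < δ → δ < r →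
      ∃ l : Plane →ᵃ[ℝ] ℝ, fderiv ℝ u x = l.linear.toContinuousLinearMap ∧
        ∀ y ∈ Metric.ball x r, truncate δ (u y) = l y := by
  choose! l hl using hu
  -- Exclude the null zero lines of the affine pieces. At a remaining point the piece either
  -- vanishes identically, and so does its truncation, or it exceeds half of its value in modulus,
  -- with constant sign, near `x`, and truncation at a smaller level only adds a constant.
  have h : ∀ᵐ x ∂(volume : Measure Plane), ∀ t ∈ T.cells, (∀ a, l t a = 0) ∨ l t x ≠ 0 := by
    rw [Finset.eventually_all]
    intro t _
    by_cases ha : ∃ a, l t a ≠ 0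
    · obtain ⟨a, ha⟩ := ha
      filter_upwards [measure_eq_zero_iff_ae_notMem.1 (volume_affineMap_zero ha)] with x hx
      exact Or.inr hx
    · push Not at ha
      exact Filter.Eventually.of_forall fun x => Or.inl ha
  filter_upwards [T.ae_exists_mem_interior hΩ, ae_restrict_of_ae h] with x ⟨t, ht, hx⟩ hlx
  have hfd : fderiv ℝ u x = (l t).linear.toContinuousLinearMap := by
    rw [(eventuallyEq_of_mem_interior (hl t ht) hx).fderiv_eq, fderiv_affineMap]
  have hc : Continuous (l t) := (contDiff_affineMap (l t)).continuous
  have hnhds := mem_interior_iff_mem_nhds.1 hx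
  have hshift : ∀ c : ℝ, ((l t) + AffineMap.const ℝ Plane c).linear = (l t).linear := by
    intro c; simp
  rcases hlx t ht with h0 | h0
  · obtain ⟨r, hr, hrs⟩ := Metric.mem_nhds_iff.1 hnhds
    refine ⟨r, hr, fun δ hδ _ => ⟨l t, hfd, fun y hy => ?_⟩⟩
    rw [hl t ht (hrs hy), h0 y, truncate_of_abs_le (by simpa using hδ.le)]
  · rcases lt_or_gt_of_ne h0 with h0 | h0
    · obtain ⟨r, hr, hrs⟩ := Metric.mem_nhds_iff.1
        (Filter.inter_mem hnhds (hc.continuousAt.eventually_lt_const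
          (show l t x < l t x / 2 by linarith)))
      refine ⟨min r (-(l t x / 2)), lt_min hr (by linarith), fun δ hδ hδr =>
        ⟨l t + AffineMap.const ℝ Plane δ, by rw [hfd, hshift], fun y hy => ?_⟩⟩
      obtain ⟨h1, h2⟩ := hrs (Metric.ball_subset_ball (min_le_left _ _) hy)
      have h3 : l t y < l t x / 2 := h2
      have h4 := hδr.trans_le (min_le_right _ _)
      rw [hl t ht h1, truncate_of_le_neg hδ (by linarith)]
      simp
    · obtain ⟨r, hr, hrs⟩ := Metric.mem_nhds_iff.1
        (Filter.inter_mem hnhds (hc.continuousAt.eventually_const_lt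
          (show l t x / 2 < l t x by linarith)))
      refine ⟨min r (l t x / 2), lt_min hr (by linarith), fun δ hδ hδr =>
        ⟨l t + AffineMap.const ℝ Plane (-δ), by rw [hfd, hshift], fun y hy => ?_⟩⟩
      obtain ⟨h1, h2⟩ := hrs (Metric.ball_subset_ball (min_le_left _ _) hy)
      have h3 : l t x / 2 < l t y := h2
      have h4 := hδr.trans_le (min_le_right _ _)
      rw [hl t ht h1, truncate_of_le hδ (by linarith)]
      simp [sub_eq_add_neg]

/-- Piecewise affine functions that vanish outside `Ω` belong to `H¹₀(Ω)`. -/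
lemma IsPiecewiseAffine.memH10 (hu : T.IsPiecewiseAffine u) (hΩ : IsOpen Ω)
    (hb : Bornology.IsBounded Ω) (h0 : ∀ x ∉ Ω, u x = 0) : MemH10 Ω u := by
  have hw := hu.hasWeakGrad hΩ hb
  have hfin := isFiniteMeasure_restrict_of_isBounded hb
  refine ⟨⟨_, hw⟩, ?_⟩
  obtain ⟨K, hK⟩ := hu.exists_lipschitzWith hΩ h0
  have hK0 : (0 : ℝ) ≤ K := K.2
  set δ : ℕ → ℝ := fun m => 1 / ((m : ℝ) + 1) with hδdef
  have hδ : ∀ m, 0 < δ m := fun m => Nat.one_div_pos_of_nat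
  have hδlim : Filter.Tendsto δ Filter.atTop (nhds 0) := tendsto_one_div_add_atTop_nhds_zero_nat
  -- The scale satisfies both `Kρ ≤ δ/2` and `ρ ≤ δ/2`. By the first, mollifying the truncation
  -- keeps its support in `{δ/2 ≤ |u|}`, hence inside `Ω`; by the second, the mollifier does not
  -- leave the neighbourhood on which the truncation is affine.
  set ρ : ℕ → ℝ := fun m => δ m / (2 * (K + 1)) with hρdef
  have hρ : ∀ m, 0 < ρ m := fun m => div_pos (hδ m) (by positivity)
  have hKρ : ∀ m, (K + 1) * ρ m = δ m / 2 := fun m => by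
    rw [hρdef]; field_simp
  have hρδ : ∀ m, ρ m ≤ δ m / 2 := fun m => by
    have := mul_nonneg hK0 (hρ m).le
    linarith [hKρ m]
  have hKρ' : ∀ m, K * ρ m ≤ δ m / 2 := fun m => by
    linarith [hKρ m, hρ m]
  set v : ℕ → Plane → ℝ := fun m x => truncate (δ m) (u x) with hvdef
  have hv : ∀ m, LipschitzWith (2 * K) (v m) := fun m => (truncate_lipschitz (δ m)).comp hK
  set ψ : ℕ → Plane → ℝ := fun m => mollify (ρ m) (hρ m) (v m) with hψdef
  have hψsupp : ∀ m, tsupport (ψ m) ⊆ {x | δ m / 2 ≤ |u x|} := by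
    intro m
    refine closure_minimal (fun x hx => ?_)
      (isClosed_le continuous_const hK.continuous.abs)
    by_contra hcon
    have hcon' : |u x| < δ m / 2 := not_le.1 hcon
    refine hx ?_
    rw [hψdef]
    dsimp only
    rw [mollify_congr (hρ m) (w := fun _ => 0) (fun y hy => ?_), mollify_zero]
    refine truncate_of_abs_le ?_
    have h1 := hK.dist_le_mul y x
    rw [Real.dist_eq] at h1
    have h2 : K * dist y x ≤ K * ρ m := mul_le_mul_of_nonneg_left hy.le hK0
    have h3 := abs_sub_abs_le_abs_sub (u y) (u x)
    linarith [hKρ' m]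
  have hsub : ∀ m, {x | δ m / 2 ≤ |u x|} ⊆ Ω := by
    intro m x hx
    by_contra hxΩ
    have hx' : δ m / 2 ≤ |u x| := hx
    rw [h0 x hxΩ, abs_zero] at hx'
    linarith [hδ m]
  have hψ : ∀ m, IsTestFunction Ω (ψ m) := fun m =>
    ⟨contDiff_mollify _ (hv m).continuous,
      Metric.isCompact_of_isClosed_isBounded (isClosed_tsupport _)
        (hb.subset ((hψsupp m).trans (hsub m))), (hψsupp m).trans (hsub m)⟩
  have hclose : ∀ m x, |u x - ψ m x| ≤ 2 * δ m := by
    intro m x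
    have h1 := abs_mollify_sub_self_le (hρ m) (hv m) x
    have h2 := abs_sub_truncate_le (hδ m) (u x)
    rw [abs_sub_comm] at h1
    have h3 := abs_sub_le (u x) (v m x) (ψ m x)
    push_cast at h1
    have h4 := hKρ' m
    calc |u x - ψ m x| ≤ δ m + 2 * K * ρ m := h3.trans (add_le_add h2 h1)
      _ ≤ 2 * δ m := by nlinarith
  have hlim1 : Filter.Tendsto (fun m => eLpNorm (fun x => u x - ψ m x) 2 (volume.restrict Ω))
      Filter.atTop (nhds 0) := by
    refine tendsto_eLpNorm_two_zero 2
      (fun m => hw.1.1.sub ((hψ m).memLp 2 _).1) (fun m => ?_) ?_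
    · refine Filter.Eventually.of_forall fun x => (hclose m x).trans ?_
      have : δ m ≤ 1 := by
        rw [hδdef]
        exact div_le_one_of_le₀ (by linarith [(Nat.cast_nonneg m : (0 : ℝ) ≤ m)]) (by positivity)
      linarith
    · refine Filter.Eventually.of_forall fun x => ?_
      refine squeeze_zero_norm (fun m => hclose m x) ?_
      simpa using hδlim.const_mul 2
  obtain ⟨C, hC⟩ := hu.exists_gradient_bound
  have hlim2 : Filter.Tendsto
      (fun m => eLpNorm (fun x => gradient u x - gradient (ψ m) x) 2 (volume.restrict Ω))
      Filter.atTop (nhds 0) := by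
    refine tendsto_eLpNorm_two_zero (C + 2 * K)
      (fun m => hw.2.1.1.sub ((hψ m).memLp_gradient 2 _).1) (fun m => ?_) ?_
    · filter_upwards [T.ae_exists_mem_interior hΩ] with x ⟨t, ht, hx⟩
      refine (norm_sub_le _ _).trans (add_le_add ?_ ?_)
      · rw [gradient, LinearIsometryEquiv.norm_map]
        exact hC t ht x hx
      · rw [gradient, LinearIsometryEquiv.norm_map]
        have hL : LipschitzWith (2 * K) (ψ m) := LipschitzWith.of_dist_le_mul fun x y =>
          abs_mollify_sub_le (hρ m) (hv m) x y
        simpa using norm_fderiv_le_of_lipschitz ℝ hL (x₀ := x)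
    -- Mollification reproduces affine functions, so at almost every point the gradients of `ψ m`
    -- and `u` are equal for all large `m`. This pointwise limit and a uniform bound give
    -- convergence in `L²`.
    · filter_upwards [hu.ae_truncate hΩ] with x ⟨r, hr, hx⟩
      have hev : ∀ᶠ m in Filter.atTop, δ m < r :=
        hδlim.eventually_lt_const hr
      refine tendsto_const_nhds.congr' ?_
      filter_upwards [hev] with m hm
      obtain ⟨l, hl1, hl2⟩ := hx (δ m) (hδ m) hm
      have hloc : ψ m =ᶠ[nhds x] l := by
        filter_upwards [Metric.ball_mem_nhds x (half_pos hr)] with y hy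
        rw [hψdef]
        dsimp only
        rw [mollify_congr (hρ m) (w := l) (fun z hz => ?_), mollify_affineMap]
        refine hl2 z ?_
        rw [Metric.mem_ball] at hy ⊢
        linarith [dist_triangle z y x, hρδ m]
      rw [gradient, gradient, hloc.fderiv_eq, hl1, fderiv_affineMap, sub_self]
  intro d hd
  obtain ⟨m, hm1, hm2⟩ := ((hlim1.eventually_lt_const hd).and
    (hlim2.eventually_lt_const hd)).exists
  refine ⟨ψ m, hψ m, hm1, ?_⟩
  refine lt_of_eq_of_lt (eLpNorm_congr_ae ?_) hm2
  filter_upwards [hw.weakGrad_ae_eq hΩ] with x hx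
  rw [hx]

end Triangulation

/-! ### Barycentric coordinates and the nodal basis -/

lemma eqOn_convexHull_of_eqOn {S : Set Plane} {l m : Plane →ᵃ[ℝ] ℝ} (h : Set.EqOn l m S) :
    Set.EqOn l m (convexHull ℝ S) := by
  have hc : Convex ℝ {x | l x = m x} := by
    have : {x | l x = m x} = (l - m) ⁻¹' {0} := by
      ext x; simp [sub_eq_zero]
    rw [this]
    exact (convex_singleton 0).affine_preimage (l - m)
  exact fun x hx => convexHull_min (fun y hy => h hy) hc hx

namespace Triangulation

variable {T : Triangulation Ω} {s t : Finset Plane}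

/-- The barycentric coordinate of the vertex `z` of the triangle `t`. -/
def bary (T : Triangulation Ω) (t : Finset Plane) (ht : t ∈ T.cells) (z : t) : Plane →ᵃ[ℝ] ℝ :=
  (T.affineBasis t ht).coord z

lemma bary_self (ht : t ∈ T.cells) (z : t) : T.bary t ht z z = 1 :=
  (T.affineBasis t ht).coord_apply_eq z

lemma bary_of_ne (ht : t ∈ T.cells) (z : t) {w : Plane} (hw : w ∈ t) (hne : (z : Plane) ≠ w) :
    T.bary t ht z w = 0 :=
  (T.affineBasis t ht).coord_apply_ne (i := z) (j := ⟨w, hw⟩) fun h => hne (congrArg Subtype.val h)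

lemma sum_bary (ht : t ∈ T.cells) (x : Plane) : ∑ z : t, T.bary t ht z x = 1 :=
  (T.affineBasis t ht).sum_coord_apply_eq_one x

lemma bary_mem_Icc (ht : t ∈ T.cells) (z : t) {x : Plane} (hx : x ∈ tri t) :
    T.bary t ht z x ∈ Set.Icc (0 : ℝ) 1 := by
  refine convexHull_min (t := T.bary t ht z ⁻¹' Set.Icc (0 : ℝ) 1) (fun w hw => ?_)
    ((convex_Icc 0 1).affine_preimage _) hx
  by_cases h : (z : Plane) = w
  · subst h
    simp [bary_self]
  · simp [bary_of_ne ht z hw h]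

lemma exists_nodalBasis_eq (T : Triangulation Ω) {z x : Plane}
    (h : ∃ t, ∃ _ : t ∈ T.cells, z ∈ t ∧ x ∈ tri t) :
    ∃ s, ∃ hs : s ∈ T.cells, ∃ hzs : z ∈ s, x ∈ tri s ∧
      T.nodalBasis z x = T.bary s hs ⟨z, hzs⟩ x :=
  ⟨h.choose, h.choose_spec.1, h.choose_spec.2.1, h.choose_spec.2.2, by
    rw [nodalBasis, dif_pos h]
    rfl⟩

/-- The triangle chosen in the definition does not matter: the coordinates belonging to `z` in two
triangles agree at the common vertices, hence on their convex hull, which by conformity is the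
intersection. -/
lemma nodalBasis_of_mem (T : Triangulation Ω) (ht : t ∈ T.cells) {z x : Plane} (hz : z ∈ t)
    (hx : x ∈ tri t) : T.nodalBasis z x = T.bary t ht ⟨z, hz⟩ x := by
  have h : ∃ t, ∃ _ : t ∈ T.cells, z ∈ t ∧ x ∈ tri t := ⟨t, ht, hz, hx⟩
  obtain ⟨s, hs, hzs, hxs, heq⟩ := T.exists_nodalBasis_eq h
  rw [heq]
  have hmem : x ∈ convexHull ℝ ((s : Set Plane) ∩ (t : Set Plane)) := by
    rw [← T.inter s hs t ht]
    exact ⟨hxs, hx⟩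
  refine eqOn_convexHull_of_eqOn (fun w hw => ?_) hmem
  by_cases hzw : z = w
  · subst hzw
    exact (bary_self hs ⟨z, hzs⟩).trans (bary_self ht ⟨z, hz⟩).symm
  · rw [bary_of_ne hs ⟨z, hzs⟩ hw.1 hzw, bary_of_ne ht ⟨z, hz⟩ hw.2 hzw]

/-- The coordinate belonging to `z` in a neighbouring triangle vanishes at every vertex shared with
`t`, hence on the intersection. -/
lemma nodalBasis_of_notMem (T : Triangulation Ω) (ht : t ∈ T.cells) {z x : Plane} (hz : z ∉ t)
    (hx : x ∈ tri t) : T.nodalBasis z x = 0 := by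
  by_cases h : ∃ t, ∃ _ : t ∈ T.cells, z ∈ t ∧ x ∈ tri t
  · obtain ⟨s, hs, hzs, hxs, heq⟩ := T.exists_nodalBasis_eq h
    rw [heq]
    have hmem : x ∈ convexHull ℝ ((s : Set Plane) ∩ (t : Set Plane)) := by
      rw [← T.inter s hs t ht]
      exact ⟨hxs, hx⟩
    refine eqOn_convexHull_of_eqOn (m := AffineMap.const ℝ Plane 0) (fun w hw => ?_) hmem
    rw [bary_of_ne hs ⟨z, hzs⟩ hw.1 fun h => hz (by
      change z = w at h
      rw [h]; exact hw.2)]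
    rfl
  · rw [nodalBasis, dif_neg h]

lemma nodalBasis_of_notMem_closure (T : Triangulation Ω) {z x : Plane} (hx : x ∉ closure Ω) :
    T.nodalBasis z x = 0 := by
  rw [nodalBasis, dif_neg]
  rintro ⟨t, ht, -, hxt⟩
  exact hx (T.tri_subset ht hxt)

lemma isPiecewiseAffine_nodalBasis (T : Triangulation Ω) (z : Plane) :
    T.IsPiecewiseAffine (T.nodalBasis z) := by
  intro t ht
  by_cases hz : z ∈ t
  · exact ⟨T.bary t ht ⟨z, hz⟩, fun x hx => T.nodalBasis_of_mem ht hz hx⟩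
  · exact ⟨AffineMap.const ℝ Plane 0, fun x hx => T.nodalBasis_of_notMem ht hz hx⟩

lemma mem_vertices (T : Triangulation Ω) {z : Plane} :
    z ∈ T.vertices ↔ ∃ t ∈ T.cells, z ∈ t := by
  simp [vertices]

/-- On a triangle, a combination of nodal basis functions is the combination of the barycentric
coordinates. -/
lemma sum_nodalBasis {V : Type*} [AddCommGroup V] [Module ℝ V] (T : Triangulation Ω)
    (ht : t ∈ T.cells) (a : Plane → V) {x : Plane} (hx : x ∈ tri t) :
    ∑ z ∈ T.vertices, T.nodalBasis z x • a z = ∑ z : t, T.bary t ht z x • a z := by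
  have hsub : t ⊆ T.vertices := fun z hz => T.mem_vertices.2 ⟨t, ht, hz⟩
  rw [← Finset.sum_subset hsub fun z _ hz => by rw [T.nodalBasis_of_notMem ht hz hx, zero_smul],
    ← Finset.sum_coe_sort t]
  exact Finset.sum_congr rfl fun z _ => by rw [T.nodalBasis_of_mem ht z.2 hx]

/-! ### Consequences of shape regularity -/

/-- A barycentric coordinate stays in `[0, 1]` on the triangle, so it changes by at most `1` from
the centre of the inscribed disc to its rim, which bounds its slope by `1 / r`. -/
lemma abs_bary_linear_le (ht : t ∈ T.cells) (z : t) {x : Plane} {r : ℝ} (hr : 0 < r)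
    (hb : Metric.closedBall x r ⊆ tri t) (v : Plane) :
    |(T.bary t ht z).linear v| ≤ ‖v‖ / r := by
  rcases eq_or_ne v 0 with rfl | hv
  · simp
  have hvn : 0 < ‖v‖ := norm_pos_iff.2 hv
  have h1 := bary_mem_Icc ht z (hb (Metric.mem_closedBall_self hr.le))
  have hy : (r / ‖v‖) • v + x ∈ tri t := hb (by
    rw [Metric.mem_closedBall, dist_eq_norm, add_sub_cancel_right, norm_smul, Real.norm_eq_abs,
      abs_of_pos (by positivity), div_mul_cancel₀ _ hvn.ne'])
  have h2 := bary_mem_Icc ht z hy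
  have h3 : T.bary t ht z ((r / ‖v‖) • v + x)
      = (r / ‖v‖) * (T.bary t ht z).linear v + T.bary t ht z x := by
    have := (T.bary t ht z).map_vadd x ((r / ‖v‖) • v)
    simpa using this
  rw [h3] at h2
  have h4 : |(r / ‖v‖) * (T.bary t ht z).linear v| ≤ 1 :=
    abs_le.2 ⟨by linarith [h1.1, h1.2, h2.1, h2.2], by linarith [h1.1, h1.2, h2.1, h2.2]⟩
  rw [abs_mul, abs_of_pos (by positivity)] at h4
  rw [le_div_iff₀ hr]
  calc |(T.bary t ht z).linear v| * r
      = ‖v‖ * (r / ‖v‖ * |(T.bary t ht z).linear v|) := by field_simp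
    _ ≤ ‖v‖ * 1 := by gcongr
    _ = ‖v‖ := mul_one _

lemma cellDiam_pos (ht : t ∈ T.cells) : 0 < cellDiam t := by
  have : 1 < t.card := by rw [T.card_eq t ht]; norm_num
  obtain ⟨a, ha, b, hb, hab⟩ := Finset.one_lt_card.1 this
  exact (dist_pos.2 hab).trans_le (dist_le_cellDiam (mem_tri ha) (mem_tri hb))

lemma ShapeRegular.pos {σ : ℝ} (hσ : T.ShapeRegular σ) (ht : t ∈ T.cells) : 0 < σ := by
  obtain ⟨x, r, hr, -, h⟩ := hσ t ht
  have := cellDiam_pos ht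
  by_contra hcon
  nlinarith

/-- Along the edge from `w` to `z` the coordinate of `z` rises from `0` to `1` with slope at most `1
/ r`, so the edge has length at least `r`. -/
lemma ShapeRegular.cellDiam_le_edge {σ : ℝ} (hσ : T.ShapeRegular σ) (ht : t ∈ T.cells)
    {z w : Plane} (hz : z ∈ t) (hw : w ∈ t) (hzw : z ≠ w) : cellDiam t ≤ σ * dist z w := by
  obtain ⟨x, r, hr, hb, h⟩ := hσ t ht
  have h1 := abs_bary_linear_le ht ⟨z, hz⟩ hr hb (z - w)
  have h2 : (T.bary t ht ⟨z, hz⟩).linear (z - w) = 1 := by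
    have := (T.bary t ht ⟨z, hz⟩).linearMap_vsub z w
    rw [vsub_eq_sub, vsub_eq_sub, bary_of_ne ht ⟨z, hz⟩ hw hzw] at this
    rw [this, sub_zero]
    exact bary_self ht ⟨z, hz⟩
  rw [h2, abs_one, le_div_iff₀ hr, one_mul, ← dist_eq_norm] at h1
  exact h.trans (mul_le_mul_of_nonneg_left h1 (hσ.pos ht).le)

/-- The number of triangles at a vertex is bounded in terms of the shape regularity. -/
lemma ShapeRegular.card_le {σ : ℝ} (hσ : T.ShapeRegular σ) (z : Plane) (A : Finset (Finset Plane))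
    (hA : ∀ t ∈ A, t ∈ T.cells ∧ z ∈ t) : (A.card : ℝ) ≤ σ ^ 2 := by
  rcases A.eq_empty_or_nonempty with rfl | hne
  · simpa using sq_nonneg σ
  obtain ⟨t₀, ht₀, hmin⟩ := A.exists_min_image cellDiam hne
  set ρ := cellDiam t₀ with hρ
  have hρ0 : 0 < ρ := cellDiam_pos (hA t₀ ht₀).1
  have hσ0 : 0 < σ := hσ.pos (hA t₀ ht₀).1
  -- Shrink each triangle towards `z` to the smallest diameter `ρ`. By convexity the copy stays in
  -- the triangle, it lies within `ρ` of `z`, and it still contains a disc of radius `ρ / σ`.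
  have hball : ∀ t ∈ A, ∃ c, Metric.closedBall c (ρ / σ) ⊆ tri t ∩ Metric.closedBall z ρ := by
    intro t ht
    obtain ⟨x, r, hr, hb, h⟩ := hσ t (hA t ht).1
    have hd : 0 < cellDiam t := cellDiam_pos (hA t ht).1
    set k := ρ / cellDiam t with hk
    have hk0 : 0 < k := by positivity
    have hk1 : k ≤ 1 := (div_le_one hd).2 (hmin t ht)
    refine ⟨z + k • (x - z), fun y hy => ?_⟩
    set w := z + k⁻¹ • (y - z) with hw
    have hyw : y = z + k • (w - z) := by
      rw [hw, add_sub_cancel_left, smul_inv_smul₀ hk0.ne', add_sub_cancel]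
    have hwb : w ∈ tri t := by
      refine hb ?_
      rw [Metric.mem_closedBall, dist_eq_norm] at hy ⊢
      have h1 : y - (z + k • (x - z)) = k • (w - x) := by
        rw [hyw]; module
      rw [h1, norm_smul, Real.norm_eq_abs, abs_of_pos hk0] at hy
      have h2 : ρ / σ ≤ k * r := by
        rw [hk, div_mul_eq_mul_div, div_le_div_iff₀ hσ0 hd]
        nlinarith
      exact le_of_mul_le_mul_left (hy.trans h2) hk0
    have hzt : z ∈ tri t := mem_tri (hA t ht).2
    refine ⟨?_, ?_⟩
    · have := (convex_tri t).add_smul_sub_mem hzt hwb ⟨hk0.le, hk1⟩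
      rwa [← hyw] at this
    · rw [Metric.mem_closedBall, dist_eq_norm, hyw, add_sub_cancel_left, norm_smul,
        Real.norm_eq_abs, abs_of_pos hk0]
      have := dist_le_cellDiam hwb hzt
      rw [dist_eq_norm] at this
      calc k * ‖w - z‖ ≤ k * cellDiam t := by gcongr
        _ = ρ := by rw [hk, div_mul_cancel₀ _ hd.ne']
  choose! c hc using hball
  -- The discs overlap only in null sets and lie in one ball of radius `ρ`; comparing areas bounds
  -- their number by `σ²`.
  have hmeas : ∑ t ∈ A, volume (Metric.closedBall (c t) (ρ / σ))
      ≤ volume (Metric.closedBall z ρ) := by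
    rw [← measure_biUnion_finset₀]
    · exact measure_mono (Set.iUnion₂_subset fun t ht => (hc t ht).trans Set.inter_subset_right)
    · intro s hs t ht hst
      refine measure_mono_null (Set.inter_subset_inter ((hc s hs).trans Set.inter_subset_left)
        ((hc t ht).trans Set.inter_subset_left)) (T.volume_tri_inter (hA s hs).1 (hA t ht).1 hst)
    · exact fun t _ => measurableSet_closedBall.nullMeasurableSet
  have hv0 : volume (Metric.ball (0 : Plane) 1) ≠ 0 := (Metric.measure_ball_pos _ _ one_pos).ne'
  have hvt : volume (Metric.ball (0 : Plane) 1) ≠ ⊤ := measure_ball_lt_top.ne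
  simp only [Measure.addHaar_closedBall volume _ (show 0 ≤ ρ / σ by positivity),
    Measure.addHaar_closedBall volume _ hρ0.le, Finset.sum_const, nsmul_eq_mul,
    finrank_euclideanSpace, Fintype.card_fin] at hmeas
  rw [← mul_assoc, ENNReal.mul_le_mul_iff_left hv0 hvt, ← ENNReal.ofReal_natCast,
    ← ENNReal.ofReal_mul (by positivity), ENNReal.ofReal_le_ofReal_iff (by positivity),
    div_pow, mul_div_assoc', div_le_iff₀ (by positivity), mul_comm (ρ ^ 2)] at hmeas
  exact le_of_mul_le_mul_right hmeas (by positivity)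

/-- The diameters of the triangles at an interior vertex have no large gaps. -/
lemma ShapeRegular.exists_cellDiam_mem {σ : ℝ} (hσ : T.ShapeRegular σ) (hΩ : IsOpen Ω)
    {z : Plane} (hz : z ∈ Ω) {d : ℝ} (hs : s ∈ T.cells) (hzs : z ∈ s) (hsd : cellDiam s ≤ d)
    (ht : t ∈ T.cells) (hzt : z ∈ t) (htd : d < cellDiam t) :
    ∃ a ∈ T.cells, z ∈ a ∧ d < cellDiam a ∧ cellDiam a ≤ σ * d := by
  classical
  by_contra hcon
  push Not at hcon
  -- Near `z` only the triangles having `z` as a vertex are present: if another one contained `z`,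
  -- the nodal function of `z` would be both `0` and `1` there.
  have hev : ∀ᶠ x in nhds z, x ∈ Ω ∧ ∀ a ∈ T.cells, z ∉ a → x ∉ tri a := by
    refine Filter.Eventually.and (hΩ.mem_nhds hz) ?_
    rw [Finset.eventually_all]
    intro a ha
    by_cases hza : z ∈ a
    · exact Filter.Eventually.of_forall fun _ h => absurd hza h
    · have hzta : z ∉ tri a := fun h => by
        have h1 := T.nodalBasis_of_notMem ha hza h
        rw [T.nodalBasis_of_mem hs hzs (mem_tri hzs)] at h1
        have h2 := bary_self hs ⟨z, hzs⟩
        simp only at h2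
        linarith
      filter_upwards [(isClosed_tri a).isOpen_compl.mem_nhds hzta] with x hx _
      exact hx
  obtain ⟨r, hr, hball⟩ := Metric.eventually_nhds_iff.1 hev
  -- The circle of radius `ρ` meets only triangles at `z`, by `ρ < r`, and meets every one of them,
  -- since no edge at `z` is shorter than `ρ`.
  obtain ⟨ρ, hρ0, hρr, hρd⟩ : ∃ ρ, 0 < ρ ∧ ρ < r ∧ ∀ a ∈ T.cells, z ∈ a → ∀ w ∈ a, w ≠ z →
      ρ ≤ dist w z := by
    have : ∀ᶠ ρ : ℝ in nhdsWithin 0 (Set.Ioi 0), ρ < r ∧ ∀ a ∈ T.cells, z ∈ a → ∀ w ∈ a, w ≠ z →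
        ρ ≤ dist w z := by
      refine Filter.Eventually.and ?_ ?_
      · exact nhdsWithin_le_nhds (Iio_mem_nhds hr)
      · rw [Finset.eventually_all]
        intro a _
        rw [Filter.eventually_imp_distrib_left]
        intro _
        rw [Finset.eventually_all]
        intro w _
        rw [Filter.eventually_imp_distrib_left]
        intro hw
        exact nhdsWithin_le_nhds (Iic_mem_nhds (dist_pos.2 hw))
    obtain ⟨ρ, h, h0⟩ := (this.and self_mem_nhdsWithin).exists
    exact ⟨ρ, h0, h.1, h.2⟩
  set small : Set Plane := ⋃ a ∈ T.cells.filter (fun a => z ∈ a ∧ cellDiam a ≤ d), tri a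
  set large : Set Plane := ⋃ a ∈ T.cells.filter (fun a => z ∈ a ∧ d < cellDiam a), tri a
  have hsc : IsClosed small :=
    (Finset.finite_toSet _).isClosed_biUnion fun a _ => isClosed_tri a
  have hlc : IsClosed large :=
    (Finset.finite_toSet _).isClosed_biUnion fun a _ => isClosed_tri a
  have hmeet : ∀ a ∈ T.cells, z ∈ a → (Metric.sphere z ρ ∩ tri a).Nonempty := by
    intro a ha hza
    have : 1 < a.card := by rw [T.card_eq a ha]; norm_num
    obtain ⟨w, hw, hwz⟩ := Finset.exists_mem_ne this z
    have hd := hρd a ha hza w hw hwz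
    have hd0 : 0 < dist w z := dist_pos.2 hwz
    refine ⟨z + (ρ / dist w z) • (w - z), ?_, ?_⟩
    · rw [mem_sphere_iff_norm, add_sub_cancel_left, norm_smul, ← dist_eq_norm, Real.norm_eq_abs,
        abs_of_pos (by positivity), div_mul_cancel₀ _ hd0.ne']
    · exact (convex_tri a).add_smul_sub_mem (mem_tri hza) (mem_tri hw)
        ⟨by positivity, (div_le_one hd0).2 hd⟩
  have hrank : 1 < Module.rank ℝ Plane := by
    rw [← Module.finrank_eq_rank, finrank_euclideanSpace, Fintype.card_fin]
    norm_num
  -- The circle is connected and covered by the closed unions of the small and the large triangles,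
  -- both of which it meets. Hence some small triangle and some large one share a point of the
  -- circle.
  have hconn := (isConnected_sphere hrank z hρ0.le).isPreconnected
  rw [isPreconnected_closed_iff] at hconn
  obtain ⟨y, hy, hys, hyl⟩ := hconn small large hsc hlc (by
      intro y hy
      obtain ⟨hyΩ, hy'⟩ := hball (show dist y z < r by rw [Metric.mem_sphere.1 hy]; exact hρr)
      obtain ⟨a, ha, hya⟩ := T.exists_mem_tri (subset_closure hyΩ)
      have hza : z ∈ a := by
        by_contra h
        exact hy' a ha h hya
      rcases le_or_gt (cellDiam a) d with h | h
      · exact Or.inl (Set.mem_biUnion (Finset.mem_coe.2 (Finset.mem_filter.2 ⟨ha, hza, h⟩)) hya)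
      · exact Or.inr (Set.mem_biUnion (Finset.mem_coe.2 (Finset.mem_filter.2 ⟨ha, hza, h⟩)) hya))
    ((hmeet s hs hzs).mono fun y hy => ⟨hy.1,
      Set.mem_biUnion (Finset.mem_coe.2 (Finset.mem_filter.2 ⟨hs, hzs, hsd⟩)) hy.2⟩)
    ((hmeet t ht hzt).mono fun y hy => ⟨hy.1,
      Set.mem_biUnion (Finset.mem_coe.2 (Finset.mem_filter.2 ⟨ht, hzt, htd⟩)) hy.2⟩)
  obtain ⟨a, ha, hya⟩ := Set.mem_iUnion₂.1 hys
  obtain ⟨b, hb, hyb⟩ := Set.mem_iUnion₂.1 hyl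
  obtain ⟨ha, hza, had⟩ := Finset.mem_filter.1 ha
  obtain ⟨hb, hzb, hbd⟩ := Finset.mem_filter.1 hb
  have hyab : y ∈ convexHull ℝ ((a : Set Plane) ∩ (b : Set Plane)) := by
    rw [← T.inter a ha b hb]
    exact ⟨hya, hyb⟩
  -- The shared point differs from `z`, so by conformity the two triangles share a second vertex
  -- `w`. The edge `zw` bounds the large diameter from above, up to `σ`, by the small one.
  obtain ⟨w, hwa, hwb, hwz⟩ : ∃ w, w ∈ a ∧ w ∈ b ∧ w ≠ z := by
    by_contra hno
    push Not at hno
    have hsub : (a : Set Plane) ∩ (b : Set Plane) ⊆ {z} := fun w hw => hno w hw.1 hw.2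
    have := convexHull_mono hsub hyab
    rw [convexHull_singleton, Set.mem_singleton_iff] at this
    rw [this, Metric.mem_sphere, dist_self] at hy
    exact hρ0.ne hy
  have h1 := hσ.cellDiam_le_edge hb hzb hwb hwz.symm
  have h2 := dist_le_cellDiam (mem_tri hza) (mem_tri hwa)
  have h3 := hcon b hb hzb hbd
  have h4 := mul_le_mul_of_nonneg_left (h2.trans had) (hσ.pos ha).le
  linarith

/-- The diameters of the triangles at an interior vertex are comparable. -/
lemma ShapeRegular.cellDiam_le {σ : ℝ} (hσ : T.ShapeRegular σ) (hΩ : IsOpen Ω)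
    {z : Plane} (hz : z ∈ Ω) (hs : s ∈ T.cells) (hzs : z ∈ s) (ht : t ∈ T.cells) (hzt : z ∈ t) :
    cellDiam t ≤ max σ 1 ^ ⌈σ ^ 2⌉₊ * cellDiam s := by
  classical
  by_contra hcon
  push Not at hcon
  set K := max σ 1
  have hK1 : 1 ≤ K := le_max_right _ _
  have hd : 0 < cellDiam s := cellDiam_pos hs
  -- As long as `K ^ k * cellDiam s` is below `cellDiam t`, each further level captures a new
  -- triangle at `z`. At `k = ⌈σ²⌉` this exceeds the number of triangles that `card_le` permits.
  have key : ∀ k : ℕ, K ^ k * cellDiam s < cellDiam t →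
      k + 1 ≤ (T.cells.filter fun a => z ∈ a ∧ cellDiam a ≤ K ^ k * cellDiam s).card := by
    intro k
    induction k with
    | zero =>
      intro _
      refine Finset.card_pos.2 ⟨s, Finset.mem_filter.2 ⟨hs, hzs, by simp⟩⟩
    | succ k ih =>
      intro hk
      have hmono : K ^ k * cellDiam s ≤ K ^ (k + 1) * cellDiam s := by
        exact mul_le_mul_of_nonneg_right (pow_le_pow_right₀ hK1 k.le_succ) hd.le
      have hpow : 1 ≤ K ^ k := one_le_pow₀ hK1
      obtain ⟨a, ha, hza, h1, h2⟩ := hσ.exists_cellDiam_mem hΩ hz hs hzs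
        (d := K ^ k * cellDiam s) (by nlinarith) ht hzt (hmono.trans_lt hk)
      refine (Nat.succ_le_succ (ih (hmono.trans_lt hk))).trans
        (Nat.succ_le_of_lt (Finset.card_lt_card ?_))
      refine (Finset.ssubset_iff_of_subset fun b hb => ?_).2 ⟨a, ?_, ?_⟩
      · obtain ⟨h3, h4, h5⟩ := Finset.mem_filter.1 hb
        exact Finset.mem_filter.2 ⟨h3, h4, h5.trans hmono⟩
      · refine Finset.mem_filter.2 ⟨ha, hza, h2.trans ?_⟩
        rw [pow_succ', mul_assoc]
        exact mul_le_mul_of_nonneg_right (le_max_left _ _) (by positivity)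
      · exact fun h => not_le.2 h1 (Finset.mem_filter.1 h).2.2
  have h1 := key _ hcon
  have h2 := hσ.card_le z (T.cells.filter fun a => z ∈ a ∧
    cellDiam a ≤ K ^ ⌈σ ^ 2⌉₊ * cellDiam s) fun a ha => by
      obtain ⟨h1, h2, -⟩ := Finset.mem_filter.1 ha
      exact ⟨h1, h2⟩
  have h3 := Nat.le_ceil (σ ^ 2)
  have h4 := (Nat.cast_le (α := ℝ)).2 h1
  push_cast at h4
  linarith

end Triangulation

/-! ### The norm of `L²(S)` -/

section L2Norm

variable {V W : Type*} [NormedAddCommGroup V] [NormedAddCommGroup W] {S : Set Plane}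

lemma l2norm_nonneg (S : Set Plane) (F : Plane → V) : 0 ≤ l2norm S F := ENNReal.toReal_nonneg

lemma l2norm_congr {F G : Plane → V} (h : F =ᵐ[volume.restrict S] G) : l2norm S F = l2norm S G := by
  rw [l2norm, l2norm, eLpNorm_congr_ae h]

lemma l2norm_le_mul {F : Plane → V} {G : Plane → W} {c : ℝ} (hc : 0 ≤ c)
    (hG : MemLp G 2 (volume.restrict S))
    (h : ∀ᵐ x ∂volume.restrict S, ‖F x‖ ≤ c * ‖G x‖) : l2norm S F ≤ c * l2norm S G := by
  have h1 := eLpNorm_le_mul_eLpNorm_of_ae_le_mul h 2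
  have h2 := ENNReal.toReal_mono (ENNReal.mul_ne_top (by simp) hG.2.ne) h1
  rwa [ENNReal.toReal_mul, ENNReal.toReal_ofReal hc] at h2

lemma l2norm_sum_le {ι : Type*} (s : Finset ι) (F : ι → Plane → V)
    (hF : ∀ i ∈ s, MemLp (F i) 2 (volume.restrict S)) :
    l2norm S (fun x => ∑ i ∈ s, F i x) ≤ ∑ i ∈ s, l2norm S (F i) := by
  have h1 := eLpNorm_sum_le (fun i hi => (hF i hi).1) (p := 2) (by norm_num)
  have h2 := ENNReal.toReal_mono (ENNReal.sum_ne_top.2 fun i hi => (hF i hi).2.ne) h1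
  rw [ENNReal.toReal_sum fun i hi => (hF i hi).2.ne] at h2
  have h3 : (∑ i ∈ s, F i) = fun x => ∑ i ∈ s, F i x := by ext1 x; simp
  rwa [h3] at h2

lemma l2norm_sub_le {F G : Plane → V} (hF : MemLp F 2 (volume.restrict S))
    (hG : MemLp G 2 (volume.restrict S)) :
    l2norm S (fun x => F x - G x) ≤ l2norm S F + l2norm S G := by
  have h1 := eLpNorm_sub_le hF.1 hG.1 (p := 2) (by norm_num)
  have h2 := ENNReal.toReal_mono (ENNReal.add_ne_top.2 ⟨hF.2.ne, hG.2.ne⟩) h1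
  rwa [ENNReal.toReal_add hF.2.ne hG.2.ne] at h2

lemma l2norm_mono_measure {S' : Set Plane} {F : Plane → V}
    (h : (volume : Measure Plane).restrict S ≤ volume.restrict S')
    (hF : MemLp F 2 (volume.restrict S')) : l2norm S F ≤ l2norm S' F :=
  ENNReal.toReal_mono hF.2.ne (eLpNorm_mono_measure F h)

end L2Norm

/-! ### Quasi-interpolation -/

namespace Triangulation

variable {T : Triangulation Ω} {t : Finset Plane}

lemma ae_restrict_tri_mem (hΩ : IsPolygonalDomain Ω) (ht : t ∈ T.cells) :
    ∀ᵐ x ∂(volume : Measure Plane).restrict (tri t), x ∈ Ω :=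
  ae_mono (T.restrict_tri_le hΩ ht) (ae_restrict_mem hΩ.isOpen.measurableSet)

/-- One `y` serves all triangles inside the ball, so the value there can be attached to a vertex.
With a small ball outside `Ω` the value is zero. -/
lemma exists_l2norm_sub_le (hΩ : IsPolygonalDomain Ω) {u : Plane → ℝ} (hu : MemH10 Ω u)
    {x₀ y₀ : Plane} {R c : ℝ} (hR : 0 < R) (hc : 0 < c)
    (hsub : Metric.closedBall y₀ (c * R) ⊆ Metric.closedBall x₀ R) :
    ∃ y ∈ Metric.closedBall y₀ (c * R), ∀ t ∈ T.cells, tri t ⊆ Metric.closedBall x₀ R →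
      l2norm (tri t) (fun x => u x - Ω.indicator u y)
        ≤ 4 * R / c * l2norm Ω (weakGrad Ω u) := by
  obtain ⟨y, hy, h⟩ := hu.exists_eLpNorm_sub_le hΩ.isOpen hR hc hsub
  refine ⟨y, hy, fun t ht htR => ?_⟩
  have h1 : l2norm (tri t) (fun x => u x - Ω.indicator u y)
      = l2norm (tri t) (fun x => Ω.indicator u x - Ω.indicator u y) := by
    refine l2norm_congr ?_
    filter_upwards [ae_restrict_tri_mem hΩ ht] with x hx
    rw [Set.indicator_of_mem hx]
  rw [h1]
  have h2 := (eLpNorm_mono_measure (p := 2) (fun x => Ω.indicator u x - Ω.indicator u y)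
    (Measure.restrict_mono_set (volume : Measure Plane) htR)).trans h
  have h3 := ENNReal.toReal_mono (ENNReal.mul_ne_top (by simp) hu.memLp_weakGrad.2.ne) h2
  rwa [ENNReal.toReal_mul, ENNReal.toReal_ofReal (by positivity)] at h3

lemma tri_subset_closedBall {z x : Plane} {R : ℝ} (hz : z ∈ t) (h : cellDiam t + dist z x ≤ R) :
    tri t ⊆ Metric.closedBall x R := fun y hy => by
  rw [Metric.mem_closedBall]
  linarith [dist_triangle y z x, dist_le_cellDiam hy (mem_tri hz)]

/-- Nodal values approximating a function in `H¹₀(Ω)`: they vanish at the vertices whose basis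
function does not vanish on the boundary. -/
lemma exists_nodal_values (hΩ : IsPolygonalDomain Ω) (σ : ℝ) :
    ∃ M : ℝ, 0 ≤ M ∧ ∀ T : Triangulation Ω, T.ShapeRegular σ → ∀ u, MemH10 Ω u →
      ∃ a : Plane → ℝ, (∀ z, a z ≠ 0 → ∀ x ∈ frontier Ω, T.nodalBasis z x = 0) ∧
        ∀ t ∈ T.cells, ∀ z ∈ t, l2norm (tri t) (fun x => u x - a z)
          ≤ M * cellDiam t * l2norm Ω (weakGrad Ω u) := by
  set Λ : ℝ := max σ 1 ^ ⌈σ ^ 2⌉₊ with hΛ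
  have hΛ1 : 1 ≤ Λ := one_le_pow₀ (le_max_right _ _)
  have hΛ0 : 0 < Λ := by linarith
  set d : ℝ := Metric.diam (closure Ω) with hd
  have hd0 : 0 ≤ d := Metric.diam_nonneg
  -- Balls at boundary points are used with radii `cellDiam t` and `2 * Λ * cellDiam t`, all below
  -- this bound; `d + 1` keeps it positive.
  obtain ⟨c, hc, hext⟩ := hΩ.lipschitz.exists_exterior_ball hΩ.isOpen hΩ.isBounded
    (2 * Λ * (d + 1)) (by positivity)
  -- This dominates the constants of the three cases: `4/c` at a boundary vertex, `8Λ/c` when the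
  -- basis function reaches the boundary, `4Λ²` otherwise.
  refine ⟨8 * Λ ^ 2 * (1 / c + 1), by positivity, fun T hσ u hu => ?_⟩
  set N := l2norm Ω (weakGrad Ω u) with hN
  have hN0 : 0 ≤ N := l2norm_nonneg _ _
  have hdiam : ∀ t ∈ T.cells, cellDiam t ≤ d := fun t ht =>
    Metric.diam_mono (T.tri_subset ht) hΩ.isBounded.closure
  have hpos : ∀ t ∈ T.cells, 0 < cellDiam t := fun t ht => cellDiam_pos ht
  have hcoef : ∀ {b h : ℝ}, 0 < h → b ≤ 8 * Λ ^ 2 * (1 / c + 1) →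
      b * h * N ≤ 8 * Λ ^ 2 * (1 / c + 1) * h * N := fun h0 hb => by gcongr
  have hΛΛ : Λ ≤ Λ ^ 2 := by nlinarith
  have hc' : 0 < 1 / c := by positivity
  have hzero : ∀ t ∈ T.cells, ∀ x ∈ frontier Ω, ∀ R, 0 < R → R ≤ 2 * Λ * (d + 1) →
      tri t ⊆ Metric.closedBall x R → l2norm (tri t) (fun x => u x - 0) ≤ 4 * R / c * N := by
    intro t ht x hx R hR hRD htR
    obtain ⟨y₀, hy₀⟩ := hext x hx R hR hRD
    obtain ⟨y, hy, h⟩ := T.exists_l2norm_sub_le hΩ hu hR hc (hy₀.trans Set.inter_subset_left)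
    have := h t ht htR
    rwa [Set.indicator_of_notMem (hy₀ hy).2] at this
  suffices h : ∀ z, ∃ a : ℝ, (a ≠ 0 → ∀ x ∈ frontier Ω, T.nodalBasis z x = 0) ∧
      ∀ t ∈ T.cells, z ∈ t → l2norm (tri t) (fun x => u x - a)
        ≤ 8 * Λ ^ 2 * (1 / c + 1) * cellDiam t * N by
    choose a ha using h
    exact ⟨a, fun z => (ha z).1, fun t ht z hz => (ha z).2 t ht hz⟩
  intro z
  by_cases hcell : ∃ s ∈ T.cells, z ∈ s
  swap
  · exact ⟨0, by simp, fun t ht hz => absurd ⟨t, ht, hz⟩ hcell⟩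
  obtain ⟨s, hs, hzs⟩ := hcell
  by_cases hzΩ : z ∈ Ω
  swap
  · have hzf : z ∈ frontier Ω := by
      rw [hΩ.isOpen.frontier_eq]
      exact ⟨T.tri_subset hs (mem_tri hzs), hzΩ⟩
    -- At a boundary vertex each triangle has its own ball, centred at `z` with radius `cellDiam t`,
    -- so the diameters need not be compared.
    refine ⟨0, by simp, fun t ht hz => ?_⟩
    have hh := hpos t ht
    have hhd := hdiam t ht
    refine (hzero t ht z hzf (cellDiam t) hh (by nlinarith)
      (tri_subset_closedBall hz (by simp))).trans ?_
    refine le_trans (le_of_eq ?_) (hcoef (b := 4 * (1 / c)) hh (by nlinarith))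
    ring
  by_cases hbad : ∃ x ∈ frontier Ω, T.nodalBasis z x ≠ 0
  -- Whether this can happen at an interior vertex need not be decided: the value `0` is admissible,
  -- since a triangle at `z` reaches the boundary at `x`, and a ball about `x` of radius comparable
  -- to `cellDiam t` contains `t`.
  · obtain ⟨x, hx, hzx⟩ := hbad
    obtain ⟨t', ht', hxt'⟩ := T.exists_mem_tri (frontier_subset_closure hx)
    have hzt' : z ∈ t' := by
      by_contra h
      exact hzx (T.nodalBasis_of_notMem ht' h hxt')
    refine ⟨0, by simp, fun t ht hz => ?_⟩
    have hh := hpos t ht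
    have hhd := hdiam t ht
    have hcmp := hσ.cellDiam_le hΩ.isOpen hzΩ ht hz ht' hzt'
    rw [← hΛ] at hcmp
    have hdist := dist_le_cellDiam (mem_tri hzt') hxt'
    refine (hzero t ht x hx (2 * Λ * cellDiam t) (by positivity)
      (mul_le_mul_of_nonneg_left (by linarith) (by positivity))
      (tri_subset_closedBall hz (by nlinarith))).trans ?_
    refine le_trans (le_of_eq ?_) (hcoef (b := 8 * Λ * (1 / c)) hh (by nlinarith))
    ring
  -- A single ball about `z` contains all triangles at `z`, and the point is taken from that same
  -- ball, whence `c = 1`.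
  · push Not at hbad
    have hh := hpos s hs
    obtain ⟨y, -, hy⟩ := T.exists_l2norm_sub_le hΩ hu (x₀ := z) (y₀ := z) (R := Λ * cellDiam s)
      (c := 1) (by positivity) one_pos (by rw [one_mul])
    refine ⟨Ω.indicator u y, fun _ => hbad, fun t ht hz => ?_⟩
    have hcmp := hσ.cellDiam_le hΩ.isOpen hzΩ hs hzs ht hz
    have hcmp' := hσ.cellDiam_le hΩ.isOpen hzΩ ht hz hs hzs
    rw [← hΛ] at hcmp hcmp'
    refine (hy t ht (tri_subset_closedBall hz (by simpa using hcmp))).trans ?_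
    refine le_trans ?_ (hcoef (b := 4 * Λ ^ 2) (hpos t ht) (by nlinarith))
    refine mul_le_mul_of_nonneg_right ?_ hN0
    nlinarith

lemma isPiecewiseAffine_sum_nodalBasis (T : Triangulation Ω) (a : Plane → ℝ) :
    T.IsPiecewiseAffine fun x => ∑ z ∈ T.vertices, T.nodalBasis z x • a z := by
  have hsum : ∀ (s : Finset Plane), T.IsPiecewiseAffine fun x => ∑ z ∈ s, T.nodalBasis z x • a z := by
    classical
    intro s
    induction s using Finset.induction_on with
    | empty => exact fun t _ => ⟨AffineMap.const ℝ Plane 0, fun x _ => by simp⟩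
    | insert b s hb ih =>
      intro t ht
      obtain ⟨l, hl⟩ := ih t ht
      obtain ⟨m, hm⟩ := T.isPiecewiseAffine_nodalBasis b t ht
      refine ⟨a b • m + l, fun x hx => ?_⟩
      have h1 := hl hx
      dsimp only at h1 ⊢
      rw [Finset.sum_insert hb, h1, hm hx]
      simp [mul_comm]
  exact hsum _

lemma gradient_bary_norm_le (ht : t ∈ T.cells) (z : t) {x : Plane} {r : ℝ} (hr : 0 < r)
    (hb : Metric.closedBall x r ⊆ tri t) (y : Plane) : ‖gradient (T.bary t ht z) y‖ ≤ 1 / r := by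
  rw [gradient, LinearIsometryEquiv.norm_map, fderiv_affineMap]
  refine ContinuousLinearMap.opNorm_le_bound _ (by positivity) fun v => ?_
  have := abs_bary_linear_le ht z hr hb v
  rw [one_div, inv_mul_eq_div]
  exact this

/-- Quasi-interpolation in the finite element space with homogeneous boundary values. -/
lemma exists_quasi_interpolation (hΩ : IsPolygonalDomain Ω) (σ : ℝ) :
    ∃ M : ℝ, 0 ≤ M ∧ ∀ T : Triangulation Ω, T.ShapeRegular σ → ∀ u, MemH10 Ω u →
      ∃ w, T.MemS0 w ∧ ∀ t ∈ T.cells,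
        l2norm (tri t) (fun x => u x - w x) ≤ M * cellDiam t * l2norm Ω (weakGrad Ω u) ∧
        l2norm (tri t) (weakGrad Ω w) ≤ M * l2norm Ω (weakGrad Ω u) := by
  obtain ⟨M, hM, hnod⟩ := exists_nodal_values hΩ σ
  -- Each of the three vertices contributes `M` to the error and `2 * M * |σ|` to the gradient. The
  -- absolute value gives a nonnegative constant before any triangulation is at hand.
  refine ⟨3 * M + 6 * M * |σ|, by positivity, fun T hσ u hu => ?_⟩
  obtain ⟨a, ha0, ha⟩ := hnod T hσ u hu
  set N := l2norm Ω (weakGrad Ω u) with hN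
  have hN0 : 0 ≤ N := l2norm_nonneg _ _
  set w : Plane → ℝ := fun x => ∑ z ∈ T.vertices, T.nodalBasis z x • a z with hw
  have hwt : ∀ t (ht : t ∈ T.cells), ∀ x ∈ tri t, w x = ∑ z : t, T.bary t ht z x • a z :=
    fun t ht x hx => T.sum_nodalBasis ht a hx
  have hpa : T.IsPiecewiseAffine w := T.isPiecewiseAffine_sum_nodalBasis a
  have hw0 : ∀ x ∉ Ω, w x = 0 := by
    intro x hx
    refine Finset.sum_eq_zero fun z _ => ?_
    by_cases hxc : x ∈ closure Ω
    · by_cases haz : a z = 0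
      · rw [haz, smul_zero]
      · rw [ha0 z haz x (by rw [hΩ.isOpen.frontier_eq]; exact ⟨hxc, hx⟩), zero_smul]
    · rw [T.nodalBasis_of_notMem_closure hxc, zero_smul]
  have hwg := hpa.hasWeakGrad hΩ.isOpen hΩ.isBounded
  refine ⟨w, ⟨⟨⟨_, hwg⟩, hpa⟩, hpa.memH10 hΩ.isOpen hΩ.isBounded hw0⟩, fun t ht => ?_⟩
  have hh : 0 < cellDiam t := cellDiam_pos ht
  have hcard : (Finset.univ : Finset t).card = 3 := by
    rw [Finset.card_univ, Fintype.card_coe, T.card_eq t ht]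
  have hfin : IsFiniteMeasure ((volume : Measure Plane).restrict (tri t)) :=
    isFiniteMeasure_restrict_of_isBounded (isCompact_tri t).isBounded
  have hua : ∀ z : Plane, MemLp (fun x => u x - a z) 2 (volume.restrict (tri t)) := fun z =>
    (hu.memLp.mono_measure (T.restrict_tri_le hΩ ht)).sub (memLp_const (a z))
  have hmem := ae_restrict_mem (μ := (volume : Measure Plane)) (isClosed_tri t).measurableSet
  constructor
  -- The coordinates sum to one, so `u - w` is the combination of the differences `u - a z` with
  -- weights in `[0, 1]`.
  · have h1 : l2norm (tri t) (fun x => u x - w x)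
        = l2norm (tri t) (fun x => ∑ z : t, T.bary t ht z x * (u x - a z)) := by
      refine l2norm_congr ?_
      filter_upwards [hmem] with x hx
      rw [hwt t ht x hx]
      simp only [mul_sub, smul_eq_mul, Finset.sum_sub_distrib, ← Finset.sum_mul, sum_bary, one_mul]
    have hle : ∀ z : t, ∀ᵐ x ∂(volume : Measure Plane).restrict (tri t),
        ‖T.bary t ht z x * (u x - a z)‖ ≤ 1 * ‖u x - a z‖ := by
      intro z
      filter_upwards [hmem] with x hx
      have := bary_mem_Icc ht z hx
      rw [norm_mul, Real.norm_of_nonneg this.1]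
      exact mul_le_mul_of_nonneg_right this.2 (norm_nonneg _)
    rw [h1]
    calc l2norm (tri t) (fun x => ∑ z : t, T.bary t ht z x * (u x - a z))
        ≤ ∑ z : t, l2norm (tri t) (fun x => T.bary t ht z x * (u x - a z)) :=
          l2norm_sum_le _ _ fun z _ => (hua z).of_le_mul
            ((contDiff_affineMap _).continuous.aestronglyMeasurable.mul (hua z).1) (hle z)
      _ ≤ ∑ z : t, M * cellDiam t * N := by
          refine Finset.sum_le_sum fun z _ => ?_
          have := l2norm_le_mul zero_le_one (hua z) (hle z)
          rw [one_mul] at this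
          exact this.trans (ha t ht z z.2)
      _ = 3 * M * cellDiam t * N := by
          rw [Finset.sum_const, hcard, nsmul_eq_mul]; push_cast; ring
      _ ≤ (3 * M + 6 * M * |σ|) * cellDiam t * N := by
          gcongr
          have : 0 ≤ 6 * M * |σ| := by positivity
          linarith
  · obtain ⟨x₀, r, hr, hball, hreg⟩ := hσ t ht
    obtain ⟨z₀, hz₀⟩ : ∃ z₀, z₀ ∈ t := by
      have : 0 < t.card := by rw [T.card_eq t ht]; norm_num
      exact Finset.card_pos.1 this
    -- The gradients of the coordinates sum to zero, so a reference value `a z₀` can be subtracted.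
    -- The constant `a z - a z₀` is then estimated in `L²` through `u`, and its factor `cellDiam t`
    -- cancels against `1 / r`.
    have hgrad : ∀ x ∈ interior (tri t),
        gradient w x = ∑ z : t, (a z - a z₀) • gradient (T.bary t ht z) x := by
      intro x hx
      have hloc : w =ᶠ[nhds x] fun y => ∑ z : t, (a z - a z₀) * T.bary t ht z y + a z₀ := by
        refine Filter.eventuallyEq_of_mem (mem_interior_iff_mem_nhds.1 hx) fun y hy => ?_
        rw [hwt t ht y hy]
        simp only [sub_mul, Finset.sum_sub_distrib, ← Finset.mul_sum, sum_bary, smul_eq_mul]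
        simp [mul_comm]
      rw [gradient, hloc.fderiv_eq, fderiv_add_const, fderiv_fun_sum fun z _ =>
        ((differentiable_affineMap _) x).const_mul _, map_sum]
      refine Finset.sum_congr rfl fun z _ => ?_
      rw [fderiv_const_mul (differentiable_affineMap _ x), gradient]
      simp
    have hint : ∀ᵐ x ∂(volume : Measure Plane).restrict (tri t), x ∈ interior (tri t) := by
      rw [ae_restrict_iff' (isClosed_tri t).measurableSet]
      filter_upwards [measure_eq_zero_iff_ae_notMem.1
        ((convex_tri t).addHaar_frontier volume)] with x hx hxt
      by_contra hcon
      exact hx ⟨subset_closure hxt, hcon⟩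
    have h1 : l2norm (tri t) (weakGrad Ω w)
        = l2norm (tri t) (fun x => ∑ z : t, (a z - a z₀) • gradient (T.bary t ht z) x) := by
      refine l2norm_congr ?_
      filter_upwards [hint, ae_mono (T.restrict_tri_le hΩ ht) (hwg.weakGrad_ae_eq hΩ.isOpen)]
        with x hx hx'
      rw [hx', hgrad x hx]
    have hle : ∀ z : t, ∀ᵐ x ∂(volume : Measure Plane).restrict (tri t),
        ‖(a z - a z₀) • gradient (T.bary t ht z) x‖ ≤ 1 / r * ‖(u x - a z₀) - (u x - a z)‖ := by
      intro z
      refine Filter.Eventually.of_forall fun x => ?_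
      rw [norm_smul, mul_comm, sub_sub_sub_cancel_left]
      exact mul_le_mul_of_nonneg_right (gradient_bary_norm_le ht z hr hball x) (norm_nonneg _)
    rw [h1]
    calc l2norm (tri t) (fun x => ∑ z : t, (a z - a z₀) • gradient (T.bary t ht z) x)
        ≤ ∑ z : t, l2norm (tri t) (fun x => (a z - a z₀) • gradient (T.bary t ht z) x) :=
          l2norm_sum_le _ _ fun z _ => ((hua z₀).sub (hua z)).of_le_mul
            ((measurable_gradient _).const_smul (a z - a z₀)).aestronglyMeasurable (hle z)
      _ ≤ ∑ z : t, 2 * M * |σ| * N := by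
          refine Finset.sum_le_sum fun z _ => ?_
          have h2 := l2norm_le_mul (by positivity) ((hua z₀).sub (hua z)) (hle z)
          have h3 := l2norm_sub_le (hua z₀) (hua z)
          have h4 := ha t ht z z.2
          have h5 := ha t ht z₀ hz₀
          have h6 : 1 / r * cellDiam t ≤ |σ| := by
            rw [one_div, inv_mul_eq_div, div_le_iff₀ hr]
            exact hreg.trans (mul_le_mul_of_nonneg_right (le_abs_self σ) hr.le)
          calc _ ≤ 1 / r * (l2norm (tri t) (fun x => u x - a z₀)
                + l2norm (tri t) (fun x => u x - a z)) :=
                h2.trans (mul_le_mul_of_nonneg_left h3 (by positivity))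
            _ ≤ 1 / r * (M * cellDiam t * N + M * cellDiam t * N) := by gcongr
            _ = 2 * M * (1 / r * cellDiam t) * N := by ring
            _ ≤ 2 * M * |σ| * N := by gcongr
      _ = 6 * M * |σ| * N := by
          rw [Finset.sum_const, hcard, nsmul_eq_mul]; push_cast; ring
      _ ≤ (3 * M + 6 * M * |σ|) * N := by
          gcongr
          linarith

end Triangulation

/-! ### Integration by parts for the recovered flux -/

/-- Integration by parts extends from test functions to `H¹₀(Ω)`. -/
lemma MemH10.integral_inner_eq_neg {F : Plane → Plane} {d : Plane → ℝ}
    (hF : MemLp F 2 (volume.restrict Ω)) (hd : MemLp d 2 (volume.restrict Ω))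
    (h : ∀ ψ, IsTestFunction Ω ψ →
      ∫ x in Ω, inner ℝ (F x) (gradient ψ x) = -∫ x in Ω, d x * ψ x)
    {v : Plane → ℝ} (hv : MemH10 Ω v) :
    ∫ x in Ω, inner ℝ (F x) (weakGrad Ω v x) = -∫ x in Ω, d x * v x := by
  set A := l2norm Ω F + l2norm Ω d with hA
  have hA0 : 0 ≤ A := add_nonneg (l2norm_nonneg _ _) (l2norm_nonneg _ _)
  have key : ∀ δ : ℝ, 0 < δ →
      |(∫ x in Ω, inner ℝ (F x) (weakGrad Ω v x)) + ∫ x in Ω, d x * v x| ≤ A * δ := by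
    intro δ hδ
    obtain ⟨ψ, hψ, h1, h2⟩ := hv.2 (ENNReal.ofReal δ) (by simpa using hδ)
    have hm1 : MemLp (fun x => v x - ψ x) 2 (volume.restrict Ω) := hv.memLp.sub (hψ.memLp 2 _)
    have hm2 : MemLp (fun x => weakGrad Ω v x - gradient ψ x) 2 (volume.restrict Ω) :=
      hv.memLp_weakGrad.sub (hψ.memLp_gradient 2 _)
    have e1 : ∫ x in Ω, inner ℝ (F x) (weakGrad Ω v x - gradient ψ x)
        = (∫ x in Ω, inner ℝ (F x) (weakGrad Ω v x)) - ∫ x in Ω, inner ℝ (F x) (gradient ψ x) := by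
      simp_rw [inner_sub_right]
      exact integral_sub (integrable_inner_of_memLp hF hv.memLp_weakGrad)
        (integrable_inner_of_memLp hF (hψ.memLp_gradient 2 _))
    have e2 : ∫ x in Ω, d x * (v x - ψ x)
        = (∫ x in Ω, d x * v x) - ∫ x in Ω, d x * ψ x := by
      simp_rw [mul_sub]
      exact integral_sub (hd.integrable_mul hv.memLp) (hd.integrable_mul (hψ.memLp 2 _))
    have b1 := abs_integral_inner_le hF hm2
    have b2 := abs_integral_mul_le hd hm1
    have c1 : (eLpNorm (fun x => weakGrad Ω v x - gradient ψ x) 2 (volume.restrict Ω)).toReal ≤ δ :=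
      ENNReal.toReal_le_of_le_ofReal hδ.le h2.le
    have c2 : (eLpNorm (fun x => v x - ψ x) 2 (volume.restrict Ω)).toReal ≤ δ :=
      ENNReal.toReal_le_of_le_ofReal hδ.le h1.le
    have e3 : (∫ x in Ω, inner ℝ (F x) (weakGrad Ω v x)) + ∫ x in Ω, d x * v x
        = (∫ x in Ω, inner ℝ (F x) (weakGrad Ω v x - gradient ψ x))
          + ∫ x in Ω, d x * (v x - ψ x) := by
      rw [e1, e2, h ψ hψ]; ring
    rw [e3, hA, add_mul]
    refine (abs_add_le _ _).trans (add_le_add (b1.trans ?_) (b2.trans ?_))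
    · exact mul_le_mul_of_nonneg_left c1 (l2norm_nonneg _ _)
    · exact mul_le_mul_of_nonneg_left c2 (l2norm_nonneg _ _)
  have hle : |(∫ x in Ω, inner ℝ (F x) (weakGrad Ω v x)) + ∫ x in Ω, d x * v x| ≤ 0 := by
    refine le_of_forall_pos_le_add fun η hη => ?_
    refine (key (η / (A + 1)) (by positivity)).trans ?_
    rw [zero_add, mul_div_assoc', div_le_iff₀ (by positivity)]
    nlinarith
  have := abs_nonpos_iff.1 hle
  linarith

namespace Triangulation

variable {T : Triangulation Ω}

lemma divergence_ae_eq {F : Plane → Plane}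
    (hF : ∀ k : Fin 2, T.IsPiecewiseAffine fun x => F x k) (hΩ : IsOpen Ω) :
    ∀ᵐ x ∂(volume : Measure Plane).restrict Ω, divergence F x
      = ∑ k : Fin 2, inner ℝ (gradient (fun x => F x k) x) (EuclideanSpace.single k (1 : ℝ)) := by
  filter_upwards [(hF 0).ae_differentiableAt hΩ, (hF 1).ae_differentiableAt hΩ] with x h0 h1
  have hd : DifferentiableAt ℝ F x := by
    rw [differentiableAt_euclidean]
    intro k
    fin_cases k
    · exact h0
    · exact h1
  refine Finset.sum_congr rfl fun k _ => ?_
  rw [inner_gradient]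
  have h2 : HasFDerivAt (fun x => F x k)
      ((EuclideanSpace.proj k : Plane →L[ℝ] ℝ).comp (fderiv ℝ F x)) x :=
    (EuclideanSpace.proj k : Plane →L[ℝ] ℝ).hasFDerivAt.comp x hd.hasFDerivAt
  rw [h2.fderiv]
  rfl

lemma memLp_divergence {F : Plane → Plane}
    (hF : ∀ k : Fin 2, T.IsPiecewiseAffine fun x => F x k) (hΩ : IsOpen Ω) (hb : Bornology.IsBounded Ω) :
    MemLp (divergence F) 2 (volume.restrict Ω) := by
  refine (memLp_congr_ae (divergence_ae_eq hF hΩ)).2 ?_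
  exact memLp_finsetSum _ fun k _ =>
    ((hF k).memLp_gradient hΩ hb 2).inner_const (EuclideanSpace.single k (1 : ℝ))

lemma memLp_of_isPiecewiseAffine {F : Plane → Plane}
    (hF : ∀ k : Fin 2, T.IsPiecewiseAffine fun x => F x k) (hΩ : IsOpen Ω) (hb : Bornology.IsBounded Ω) :
    MemLp F 2 (volume.restrict Ω) :=
  (memLp_piLp_iff (q := 2)).2 fun k => (hF k).memLp hΩ hb 2

/-- Integration by parts for continuous piecewise affine vector fields. -/
lemma integral_inner_weakGrad_eq {F : Plane → Plane}
    (hF : ∀ k : Fin 2, T.IsPiecewiseAffine fun x => F x k) (hΩ : IsOpen Ω) (hb : Bornology.IsBounded Ω)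
    {v : Plane → ℝ} (hv : MemH10 Ω v) :
    ∫ x in Ω, inner ℝ (F x) (weakGrad Ω v x) = -∫ x in Ω, divergence F x * v x := by
  refine hv.integral_inner_eq_neg (memLp_of_isPiecewiseAffine hF hΩ hb)
    (memLp_divergence hF hΩ hb) fun ψ hψ => ?_
  have h1 : ∀ x, inner ℝ (F x) (gradient ψ x)
      = ∑ k : Fin 2, F x k * fderiv ℝ ψ x (EuclideanSpace.single k 1) := by
    intro x
    rw [PiLp.inner_apply]
    refine Finset.sum_congr rfl fun k _ => ?_
    rw [← inner_gradient, EuclideanSpace.inner_single_right]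
    simp [mul_comm]
  have hd : ∀ k : Fin 2, MemLp (fun x => fderiv ℝ ψ x (EuclideanSpace.single k 1)) 2
      (volume.restrict Ω) := fun k => by
    simpa only [inner_gradient] using
      (hψ.memLp_gradient 2 (volume.restrict Ω)).inner_const (𝕜 := ℝ) (EuclideanSpace.single k 1)
  have h2 : ∫ x in Ω, divergence F x * ψ x = ∫ x in Ω, ∑ k : Fin 2,
      inner ℝ (gradient (fun x => F x k) x) (EuclideanSpace.single k (1 : ℝ)) * ψ x := by
    refine integral_congr_ae ?_
    filter_upwards [divergence_ae_eq hF hΩ] with x hx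
    rw [hx, Finset.sum_mul]
  simp_rw [h1]
  rw [h2, integral_finsetSum, integral_finsetSum, ← Finset.sum_neg_distrib]
  · exact Finset.sum_congr rfl fun k _ => ((hF k).hasWeakGrad hΩ hb).2.2 ψ hψ _
  · exact fun k _ => hψ.integrable_inner_mul ((hF k).memLp_gradient hΩ hb 2) _
  · exact fun k _ => ((hF k).memLp hΩ hb 2).integrable_mul (hd k)

/-- This is the gain from averaging: unlike `ε∇φ_h`, the recovered flux is affine on closed
triangles with matching values on common edges, so its pointwise divergence is the weak one. -/
lemma isPiecewiseAffine_fluxRecovery (T : Triangulation Ω) (wt : Plane → Finset Plane → ℝ)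
    (ε v : Plane → ℝ) (k : Fin 2) :
    T.IsPiecewiseAffine fun x => T.fluxRecovery wt ε v x k := by
  classical
  have := T.isPiecewiseAffine_sum_nodalBasis
    (fun z => (∑ t ∈ T.cells with z ∈ t, wt z t • ε z • cellGrad v t) k)
  convert this using 2 with x
  simp [fluxRecovery]

end Triangulation

/-! ### The error estimate -/

lemma memLp_smul_of_continuousOn (hΩ : IsOpen Ω) {ε : Plane → ℝ} (hε : ContinuousOn ε (closure Ω))
    (hb : Bornology.IsBounded Ω) {F : Plane → Plane} (hF : MemLp F 2 (volume.restrict Ω)) :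
    MemLp (fun x => ε x • F x) 2 (volume.restrict Ω) := by
  obtain ⟨C, hC⟩ := hb.isCompact_closure.exists_bound_of_continuousOn hε
  refine hF.of_le_mul (c := C) ?_ ?_
  · exact ((hε.mono subset_closure).aestronglyMeasurable hΩ.measurableSet).smul hF.1
  · filter_upwards [ae_restrict_mem hΩ.measurableSet] with x hx
    rw [norm_smul]
    exact mul_le_mul_of_nonneg_right (hC x (subset_closure hx)) (norm_nonneg _)

lemma memLp_charge {n : ℕ} {q : Fin n → ℝ} {f : Plane → ℝ} {p : Fin n → Plane → ℝ}
    {μ : Measure Plane} (hf : MemLp f 2 μ) (hp : ∀ i, MemLp (p i) 2 μ) :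
    MemLp (charge q f p) 2 μ :=
  (memLp_finsetSum _ fun i _ => (hp i).const_mul (q i)).add hf

lemma mul_sq_l2norm_le (hΩ : IsOpen Ω) {ε : Plane → ℝ} {ε₀ : ℝ} (h : ∀ x ∈ Ω, ε₀ ≤ ε x)
    {F : Plane → Plane} (hF : MemLp F 2 (volume.restrict Ω))
    (hεF : MemLp (fun x => ε x • F x) 2 (volume.restrict Ω)) :
    ε₀ * l2norm Ω F ^ 2 ≤ ∫ x in Ω, inner ℝ (ε x • F x) (F x) := by
  rw [l2norm, sq_toReal_eLpNorm hF, ← integral_const_mul]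
  refine integral_mono_ae ((integrable_inner_of_memLp hF hF).const_mul _)
    (integrable_inner_of_memLp hεF hF) ?_
  filter_upwards [ae_restrict_mem hΩ.measurableSet] with x hx
  rw [real_inner_smul_left]
  exact mul_le_mul_of_nonneg_right (h x hx) real_inner_self_nonneg

lemma abs_integral_charge_sub_le {n : ℕ} (q : Fin n → ℝ) (f : Plane → ℝ)
    {p ph : Fin n → Plane → ℝ} (hp : ∀ i, MemLp (p i) 2 (volume.restrict Ω))
    (hph : ∀ i, MemLp (ph i) 2 (volume.restrict Ω)) {v : Plane → ℝ}
    (hv : MemLp v 2 (volume.restrict Ω)) :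
    |∫ x in Ω, (charge q f p x - charge q f ph x) * v x|
      ≤ (∑ i, |q i|) * (∑ i, l2norm Ω (fun x => p i x - ph i x)) * l2norm Ω v := by
  have h1 : ∀ x, (charge q f p x - charge q f ph x) * v x
      = ∑ i, q i * ((p i x - ph i x) * v x) := by
    intro x
    simp only [charge, add_sub_add_right_eq_sub, ← Finset.sum_sub_distrib, Finset.sum_mul]
    exact Finset.sum_congr rfl fun i _ => by ring
  have hm : ∀ i, MemLp (fun x => p i x - ph i x) 2 (volume.restrict Ω) :=
    fun i => (hp i).sub (hph i)
  have hi : ∀ i, Integrable (fun x => (p i x - ph i x) * v x) (volume.restrict Ω) :=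
    fun i => (hm i).integrable_mul hv
  simp_rw [h1]
  rw [integral_finsetSum _ fun i _ => (hi i).const_mul (q i)]
  simp_rw [integral_const_mul]
  refine (Finset.abs_sum_le_sum_abs _ _).trans ?_
  rw [mul_assoc, Finset.sum_mul]
  refine Finset.sum_le_sum fun i _ => ?_
  rw [abs_mul]
  refine mul_le_mul_of_nonneg_left ((abs_integral_mul_le (hm i) hv).trans ?_) (abs_nonneg _)
  exact mul_le_mul_of_nonneg_right (Finset.single_le_sum
    (f := fun i => l2norm Ω (fun x => p i x - ph i x)) (fun _ _ => l2norm_nonneg _ _)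
    (Finset.mem_univ i)) (l2norm_nonneg _ _)

lemma residual_eq (T : Triangulation Ω) (wt : Plane → Finset Plane → ℝ) {n : ℕ} (q : Fin n → ℝ)
    (ε f : Plane → ℝ) (ph : Fin n → Plane → ℝ) (φh : Plane → ℝ) (x : Plane) :
    residual T wt q ε f ph φh x
      = charge q f ph x + divergence (T.fluxRecovery wt ε φh) x := by
  rw [residual, charge]; ring

/-- The error representation: the discrete equations allow to subtract any `w ∈ S^h_0`. -/
lemma error_representation (hΩ : IsPolygonalDomain Ω) {n : ℕ} {q : Fin n → ℝ} {ε f : Plane → ℝ}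
    (hε : ContinuousOn ε (closure Ω)) (hf : MemLp f 2 (volume.restrict Ω)) (T : Triangulation Ω)
    (wt : Plane → Finset Plane → ℝ) {p ph : Fin n → Plane → ℝ} {φ φh : Plane → ℝ}
    (hp : ∀ i, MemH10 Ω (p i)) (hph : ∀ i, MemH10 Ω (ph i))
    (hφ : MemH10 Ω φ) (hφh : MemH10 Ω φh)
    (hpot : ∀ w, MemH10 Ω w → formE Ω ε φ w = ∫ x in Ω, charge q f p x * w x)
    (hpoth : ∀ w, T.MemS0 w → formE Ω ε φh w = ∫ x in Ω, charge q f ph x * w x)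
    {e w : Plane → ℝ} (he : e = fun x => φ x - φh x) (hw : T.MemS0 w) :
    ∫ x in Ω, inner ℝ (ε x • weakGrad Ω e x) (weakGrad Ω e x)
      = (∫ x in Ω, (charge q f p x - charge q f ph x) * e x)
        + (∫ x in Ω, residual T wt q ε f ph φh x * (e x - w x))
        + ∫ x in Ω, inner ℝ (fluxDefect T wt ε φh x) (weakGrad Ω (fun x => e x - w x) x) := by
  have hopen := hΩ.isOpen
  have hb := hΩ.isBounded
  have heH : MemH10 Ω e := he ▸ hφ.sub hopen hφh
  have hdH : MemH10 Ω (fun x => e x - w x) := heH.sub hopen hw.2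
  set G := T.fluxRecovery wt ε φh with hG
  have hGa := T.isPiecewiseAffine_fluxRecovery wt ε φh
  have hGm : MemLp G 2 (volume.restrict Ω) := Triangulation.memLp_of_isPiecewiseAffine hGa hopen hb
  have hdiv : MemLp (divergence G) 2 (volume.restrict Ω) :=
    Triangulation.memLp_divergence hGa hopen hb
  have hcp : MemLp (charge q f p) 2 (volume.restrict Ω) := memLp_charge hf fun i => (hp i).memLp
  have hcph : MemLp (charge q f ph) 2 (volume.restrict Ω) := memLp_charge hf fun i => (hph i).memLp
  have hεφ := memLp_smul_of_continuousOn hopen hε hb hφ.memLp_weakGrad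
  have hεφh := memLp_smul_of_continuousOn hopen hε hb hφh.memLp_weakGrad
  have e1 : ∫ x in Ω, inner ℝ (ε x • weakGrad Ω e x) (weakGrad Ω e x)
      = formE Ω ε φ e - formE Ω ε φh e := by
    rw [formE, formE, ← integral_sub (integrable_inner_of_memLp hεφ heH.memLp_weakGrad)
      (integrable_inner_of_memLp hεφh heH.memLp_weakGrad)]
    refine integral_congr_ae ?_
    filter_upwards [weakGrad_sub_ae_eq hopen hφ.1 hφh.1] with x hx
    rw [← inner_sub_left, ← smul_sub, ← hx, ← he]
  have e2 : ∫ x in Ω, (charge q f p x - charge q f ph x) * e x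
      = (∫ x in Ω, charge q f p x * e x) - ∫ x in Ω, charge q f ph x * e x := by
    simp_rw [sub_mul]
    exact integral_sub (hcp.integrable_mul heH.memLp) (hcph.integrable_mul heH.memLp)
  -- Integration by parts turns the divergence into a term in `G`, which cancels against the one in
  -- `e4`.
  have e3 : ∫ x in Ω, residual T wt q ε f ph φh x * (e x - w x)
      = (∫ x in Ω, charge q f ph x * e x) - (∫ x in Ω, charge q f ph x * w x)
        - ∫ x in Ω, inner ℝ (G x) (weakGrad Ω (fun x => e x - w x) x) := by
    rw [Triangulation.integral_inner_weakGrad_eq hGa hopen hb hdH]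
    simp_rw [residual_eq, add_mul]
    have i1 : Integrable (fun x => charge q f ph x * (e x - w x)) (volume.restrict Ω) :=
      hcph.integrable_mul hdH.memLp
    have i2 : Integrable (fun x => divergence G x * (e x - w x)) (volume.restrict Ω) :=
      hdiv.integrable_mul hdH.memLp
    have i3 : Integrable (fun x => charge q f ph x * e x) (volume.restrict Ω) :=
      hcph.integrable_mul heH.memLp
    have i4 : Integrable (fun x => charge q f ph x * w x) (volume.restrict Ω) :=
      hcph.integrable_mul hw.2.memLp
    rw [integral_add i1 i2, ← integral_sub i3 i4]
    simp_rw [← mul_sub]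
    ring
  have e4 : ∫ x in Ω, inner ℝ (fluxDefect T wt ε φh x) (weakGrad Ω (fun x => e x - w x) x)
      = (∫ x in Ω, inner ℝ (G x) (weakGrad Ω (fun x => e x - w x) x))
        - formE Ω ε φh (fun x => e x - w x) := by
    simp_rw [fluxDefect, inner_sub_left]
    exact integral_sub (integrable_inner_of_memLp hGm hdH.memLp_weakGrad)
      (integrable_inner_of_memLp hεφh hdH.memLp_weakGrad)
  have e5 : formE Ω ε φh (fun x => e x - w x) = formE Ω ε φh e - formE Ω ε φh w := by
    rw [formE, formE, formE, ← integral_sub (integrable_inner_of_memLp hεφh heH.memLp_weakGrad)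
      (integrable_inner_of_memLp hεφh hw.2.memLp_weakGrad)]
    refine integral_congr_ae ?_
    filter_upwards [weakGrad_sub_ae_eq hopen heH.1 hw.2.1] with x hx
    rw [hx, inner_sub_right]
  rw [e1, e2, e3, e4, e5, hpot e heH, hpoth w hw]
  ring

/-- The bound `b t` is kept separate from `v` so that the quasi-interpolation estimate, with its
factor `h_τ` and its global norm, can be inserted. -/
lemma Triangulation.abs_integral_mul_le_sum (T : Triangulation Ω) (hΩ : IsPolygonalDomain Ω)
    {F v : Plane → ℝ} (hF : MemLp F 2 (volume.restrict Ω)) (hv : MemLp v 2 (volume.restrict Ω))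
    {b : Finset Plane → ℝ} (h : ∀ t ∈ T.cells, l2norm (tri t) v ≤ b t) :
    |∫ x in Ω, F x * v x| ≤ ∑ t ∈ T.cells, l2norm (tri t) F * b t := by
  have hi : Integrable (fun x => F x * v x) (volume.restrict Ω) := hF.integrable_mul hv
  rw [T.integral_eq_sum hΩ hi]
  refine (Finset.abs_sum_le_sum_abs _ _).trans (Finset.sum_le_sum fun t ht => ?_)
  have hle := T.restrict_tri_le hΩ ht
  exact (abs_integral_mul_le (hF.mono_measure hle) (hv.mono_measure hle)).trans
    (mul_le_mul_of_nonneg_left (h t ht) (l2norm_nonneg (tri t) F))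

lemma Triangulation.abs_integral_inner_le_sum (T : Triangulation Ω) (hΩ : IsPolygonalDomain Ω)
    {F G : Plane → Plane} (hF : MemLp F 2 (volume.restrict Ω)) (hG : MemLp G 2 (volume.restrict Ω))
    {b : Finset Plane → ℝ} (h : ∀ t ∈ T.cells, l2norm (tri t) G ≤ b t) :
    |∫ x in Ω, inner ℝ (F x) (G x)| ≤ ∑ t ∈ T.cells, l2norm (tri t) F * b t := by
  rw [T.integral_eq_sum hΩ (integrable_inner_of_memLp hF hG)]
  refine (Finset.abs_sum_le_sum_abs _ _).trans (Finset.sum_le_sum fun t ht => ?_)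
  have hle := T.restrict_tri_le hΩ ht
  exact (abs_integral_inner_le (hF.mono_measure hle) (hG.mono_measure hle)).trans
    (mul_le_mul_of_nonneg_left (h t ht) (l2norm_nonneg (tri t) F))

lemma memLp_residual (hΩ : IsOpen Ω) (hb : Bornology.IsBounded Ω) (T : Triangulation Ω)
    (wt : Plane → Finset Plane → ℝ) {n : ℕ} (q : Fin n → ℝ) (ε : Plane → ℝ) {f : Plane → ℝ}
    (hf : MemLp f 2 (volume.restrict Ω)) {ph : Fin n → Plane → ℝ}
    (hph : ∀ i, MemLp (ph i) 2 (volume.restrict Ω)) (φh : Plane → ℝ) :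
    MemLp (residual T wt q ε f ph φh) 2 (volume.restrict Ω) := by
  have : residual T wt q ε f ph φh
      = charge q f ph + divergence (T.fluxRecovery wt ε φh) := by
    ext x; exact residual_eq T wt q ε f ph φh x
  rw [this]
  exact (memLp_charge hf hph).add (Triangulation.memLp_divergence
    (T.isPiecewiseAffine_fluxRecovery wt ε φh) hΩ hb)

lemma memLp_fluxDefect (hΩ : IsOpen Ω) (hb : Bornology.IsBounded Ω) (T : Triangulation Ω)
    (wt : Plane → Finset Plane → ℝ) {ε : Plane → ℝ} (hε : ContinuousOn ε (closure Ω))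
    {φh : Plane → ℝ} (hφh : MemH10 Ω φh) :
    MemLp (fluxDefect T wt ε φh) 2 (volume.restrict Ω) :=
  (Triangulation.memLp_of_isPiecewiseAffine (T.isPiecewiseAffine_fluxRecovery wt ε φh) hΩ hb).sub
    (memLp_smul_of_continuousOn hΩ hε hb hφh.memLp_weakGrad)

/-- The conclusion drawn from the error representation by absorbing one factor `N`. -/
lemma le_of_mul_sq_le {c N a M A B S : ℝ} (hc : 0 < c) (hN : 0 ≤ N) (ha : 0 ≤ a) (hM : 0 ≤ M)
    (hA : 0 ≤ A) (hB : 0 ≤ B) (hS : 0 ≤ S)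
    (h : c * N ^ 2 ≤ a * S * N + M * N * A + (M + 1) * N * B) :
    N ≤ (a + M + 1) / c * (A + B + S) := by
  rw [div_mul_eq_mul_div, le_div_iff₀ hc]
  have hle : a * S + M * A + (M + 1) * B ≤ (a + M + 1) * (A + B + S) := by
    nlinarith [mul_nonneg ha hA, mul_nonneg ha hB, mul_nonneg hM hS]
  rcases hN.eq_or_lt with h0 | h0
  · rw [← h0, zero_mul]
    positivity
  · refine le_trans ?_ hle
    refine le_of_mul_le_mul_right ?_ h0
    linarith [h, sq N]

end PNP

end

/-! ### The a posteriori estimate for the potential -/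

theorem mainTheorem1 (Ω : Set PNP.Plane) (hΩ : PNP.IsPolygonalDomain Ω)
    (n : ℕ) (q : Fin n → ℝ)
    (ε : PNP.Plane → ℝ) (hε : ContDiffOn ℝ ∞ ε (closure Ω)) (hεpos : ∀ x ∈ closure Ω, 0 < ε x)
    (σ : ℝ) :
    ∃ C : ℝ, 0 < C ∧
      ∀ (α : PNP.Plane → ℝ → ℝ) (β : PNP.Plane → ℝ → PNP.Plane) (γ g : PNP.Plane → ℝ → ℝ)
        (f : PNP.Plane → ℝ),
        ContDiffOn ℝ ∞ (fun z : PNP.Plane × ℝ => α z.1 z.2) (closure Ω ×ˢ Set.univ) →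
        ContDiffOn ℝ ∞ (fun z : PNP.Plane × ℝ => β z.1 z.2) (closure Ω ×ˢ Set.univ) →
        ContDiffOn ℝ ∞ (fun z : PNP.Plane × ℝ => γ z.1 z.2) (closure Ω ×ˢ Set.univ) →
        ContDiffOn ℝ ∞ (fun z : PNP.Plane × ℝ => g z.1 z.2) (closure Ω ×ˢ Set.univ) →
        MemLp f 2 (volume.restrict Ω) →
      ∀ (T : PNP.Triangulation Ω), T.ShapeRegular σ →
      ∀ (wt : PNP.Plane → Finset PNP.Plane → ℝ), T.IsAveragingWeight wt →
      ∀ (p : Fin n → PNP.Plane → ℝ) (φ : PNP.Plane → ℝ),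
        PNP.IsWeakSolution Ω q α β γ g ε f p φ →
      ∀ (ph : Fin n → PNP.Plane → ℝ) (φh : PNP.Plane → ℝ),
        PNP.IsFESolution T q α β γ g ε f ph φh →
        PNP.l2norm Ω (PNP.weakGrad Ω (fun x => φ x - φh x)) ≤
          C * (PNP.estimator T wt q ε f ph φh
            + ∑ i, PNP.l2norm Ω (fun x => p i x - ph i x)) := by
  open PNP in
  have hopen := hΩ.isOpen
  have hb := hΩ.isBounded
  have hεc : ContinuousOn ε (closure Ω) := hε.continuousOn
  -- The minimum of `ε` on the compact closure is attained, hence positive; it is the coercivity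
  -- constant.
  obtain ⟨x₀, hx₀, hmin⟩ := hb.isCompact_closure.exists_isMinOn hΩ.isConnected.nonempty.closure hεc
  have hε₀ : 0 < ε x₀ := hεpos x₀ hx₀
  obtain ⟨M, hM, hquasi⟩ := Triangulation.exists_quasi_interpolation hΩ σ
  obtain ⟨P, hP, hpoin⟩ := MemH10.l2norm_le_of_isBounded hopen hb
  have hQ : 0 ≤ ∑ i, |q i| := Finset.sum_nonneg fun _ _ => abs_nonneg _
  -- The charge term gives `∑ |q i|` times the Poincaré constant, the residual `M` and the flux
  -- defect `M + 1`.
  refine ⟨((∑ i, |q i|) * P + M + 1) / ε x₀, by positivity, ?_⟩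
  intro α β γ g f _ _ _ _ hf T hσ wt _ p φ hsol ph φh hfe
  have hph : ∀ i, MemH10 Ω (ph i) := fun i => (hfe.p_mem i).2
  have hφh : MemH10 Ω φh := hfe.phi_mem.2
  obtain ⟨e, he⟩ : ∃ e : Plane → ℝ, e = fun x => φ x - φh x := ⟨_, rfl⟩
  have heH : MemH10 Ω e := he ▸ hsol.phi_mem.sub hopen hφh
  -- The quasi-interpolant is that of the error itself, so all bounds come out in terms of `‖∇e‖`.
  obtain ⟨w, hw, hwt⟩ := hquasi T hσ e heH
  have hdH : MemH10 Ω (fun x => e x - w x) := heH.sub hopen hw.2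
  have hrep := error_representation hΩ hεc hf T wt hsol.p_mem hph hsol.phi_mem hφh hsol.potential
    hfe.potential he hw
  have hlower := mul_sq_l2norm_le (ε₀ := ε x₀) hopen (fun x hx => hmin (subset_closure hx))
    heH.memLp_weakGrad (memLp_smul_of_continuousOn hopen hεc hb heH.memLp_weakGrad)
  have hcharge := (le_abs_self _).trans (abs_integral_charge_sub_le q f
    (fun i => (hsol.p_mem i).memLp) (fun i => (hph i).memLp) heH.memLp)
  have hres := (le_abs_self _).trans (T.abs_integral_mul_le_sum hΩ
    (memLp_residual hopen hb T wt q ε hf (fun i => (hph i).memLp) φh) hdH.memLp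
    fun t ht => (hwt t ht).1)
  -- On each triangle `∇(e - w)` is bounded by `∇e` plus `∇w`, which produces the factor `M + 1`.
  have hflux := (le_abs_self _).trans (T.abs_integral_inner_le_sum hΩ
    (memLp_fluxDefect hopen hb T wt hεc hφh) hdH.memLp_weakGrad
    (b := fun _ => (M + 1) * l2norm Ω (weakGrad Ω e)) fun t ht => by
      have hle := T.restrict_tri_le hΩ ht
      rw [l2norm_congr (ae_mono hle (weakGrad_sub_ae_eq hopen heH.1 hw.2.1))]
      refine (l2norm_sub_le (heH.memLp_weakGrad.mono_measure hle)
        (hw.2.memLp_weakGrad.mono_measure hle)).trans ?_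
      have h1 := l2norm_mono_measure hle heH.memLp_weakGrad
      linarith [(hwt t ht).2])
  have hpe := hpoin e heH
  rw [hrep] at hlower
  have hS : 0 ≤ ∑ i, l2norm Ω (fun x => p i x - ph i x) :=
    Finset.sum_nonneg fun _ _ => l2norm_nonneg _ _
  rw [← he, estimator, Finset.sum_add_distrib]
  refine le_of_mul_sq_le hε₀ (l2norm_nonneg _ _) (mul_nonneg hQ hP) hM
    (Finset.sum_nonneg fun t _ => mul_nonneg Metric.diam_nonneg (l2norm_nonneg _ _))
    (Finset.sum_nonneg fun t _ => l2norm_nonneg _ _) hS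
    (hlower.trans (add_le_add (add_le_add (hcharge.trans ?_) (hres.trans (le_of_eq ?_)))
      (hflux.trans (le_of_eq ?_))))
  · refine (mul_le_mul_of_nonneg_left hpe (mul_nonneg hQ hS)).trans (le_of_eq ?_)
    ring
  · rw [Finset.mul_sum]
    exact Finset.sum_congr rfl fun t _ => by ring
  · rw [← Finset.sum_mul, mul_comm]
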